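/- Let $\Delta=\{z\in\mathbb C:|z|<1\}$ and let $\mathcal S$ be the class of analytic injective functions $f:\Delta\to\mathbb C$ with $f(0)=0$ and $f'(0)=1$. For $f\in\mathcal S$ let $$Q_f(z,w)=\frac{f(z)-f(w)}{z-w}\cdot\frac{z}{f(z)}\cdot\frac{w}{f(w)},\qquad z,w\in\Delta,$$ where $\frac{f(z)-f(w)}{z-w}$ is understood as $f'(z)$ for $z=w$ and $\frac{z}{f(z)}$ as $1$ for $z=0$. There is an analytic function $F$ on $\Delta^2$ with $e^{F}=Q_f$ and $F(0,0)=0$ (the analytic branch of $\log Q_f$ that vanishes at the origin; it is unique). For integers $p,q\ge 1$ define the higher-order Schwarzian derivative $$S_f^{[p,q]}(z)=\frac{\partial^{p+q}F}{\partial z^p\,\partial w^q}(z,z),\qquad z\in\Delta.$$ Then, for every $f\in\mathcal S$ and all integers $p,q\ge1$, the function $S_f^{[p,q]}$ is analytic in $\Delta$ and belongs to the growth space $\mathcal B_{p+q}$ of analytic functions $\phi$ on $\Delta$ with $\|\phi\|_{\mathcal B_{p+q}}=\sup_{z\in\Delta}|\phi(z)|(1-|z|^2)^{p+q}<\infty$,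 and $$\|S_f^{[p,q]}\|_{\mathcal B_{p+q}}=\sup_{z\in\Delta}|S_f^{[p,q]}(z)|(1-|z|^2)^{p+q}\le\sqrt{(2p-1)!\,(2q-1)!}.$$ -/

import Mathlib

noncomputable section

namespace HigherSchwarzian

/-- The open unit disk of the complex plane. -/
def unitDisk : Set ℂ := Metric.ball 0 1

/-- The class of functions that are analytic and injective in the unit disk,
normalized by `f 0 = 0` and `f' 0 = 1`. Values outside the disk are irrelevant. -/
structure IsClassS (f : ℂ → ℂ) : Prop where
  analytic : DifferentiableOn ℂ f unitDisk
  injective : Set.InjOn f unitDisk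
  map_zero : f 0 = 0
  deriv_zero : deriv f 0 = 1

/-- The function `(f z - f w) / (z - w) * (z / f z) * (w / f w)`, with its singularities removed:
`(f z - f w) / (z - w)` is read as `deriv f z` when `z = w`, and `z / f z` as `1 / deriv f 0`
when `z = 0`. This is what `dslope` does, since `f 0 = 0`. -/
def quotient (f : ℂ → ℂ) (z w : ℂ) : ℂ :=
  dslope f z w * (dslope f 0 z)⁻¹ * (dslope f 0 w)⁻¹

/-- `F` is the single-valued analytic branch on the bidisk of the logarithm of `quotient f`
that vanishes at the origin. -/
structure IsLogBranch (f : ℂ → ℂ) (F : ℂ × ℂ → ℂ) : Prop where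
  analytic : DifferentiableOn ℂ F (unitDisk ×ˢ unitDisk)
  exp_eq : ∀ z ∈ unitDisk, ∀ w ∈ unitDisk, Complex.exp (F (z, w)) = quotient f z w
  zero : F (0, 0) = 0

/-- The mixed partial derivative `∂^(p+q) F / ∂z^p ∂w^q` at `(z, w)`. -/
def mixedPartial (F : ℂ × ℂ → ℂ) (p q : ℕ) (z w : ℂ) : ℂ :=
  iteratedDeriv p (fun ζ => iteratedDeriv q (fun ω => F (ζ, ω)) w) z

/-- The higher-order Schwarzian derivative: the mixed partial derivative on the diagonal. -/
def schwarzian (F : ℂ × ℂ → ℂ) (p q : ℕ) (z : ℂ) : ℂ :=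
  mixedPartial F p q z z

/-- The weighted supremum norm of the growth space of exponent `γ`. -/
def growthNorm (γ : ℝ) (φ : ℂ → ℂ) : ℝ :=
  ⨆ z : unitDisk, ‖φ z‖ * (1 - ‖(z : ℂ)‖ ^ 2) ^ γ

/-- Membership in the growth space of exponent `γ`: analytic in the disk, with finite norm. -/
structure MemGrowth (γ : ℝ) (φ : ℂ → ℂ) : Prop where
  analytic : DifferentiableOn ℂ φ unitDisk
  bounded : BddAbove (Set.range fun z : unitDisk => ‖φ z‖ * (1 - ‖(z : ℂ)‖ ^ 2) ^ γ)

end HigherSchwarzian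

end

open Set Filter Topology MeasureTheory

namespace HigherSchwarzian

/-! The bound is Grunsky's inequality applied to the charges that represent derivatives by Cauchy's
formula.

`F` measures how `1/f` distorts distances: with `h t = r / f (r e^{it})`, the distance `|h t - h s|`
is `|e^{it} - e^{is}|` times `exp (Re F)` at the corresponding points (`norm_inv_sub_inv`). The
logarithmic energy of a real charge of total mass zero is nonnegative after any continuous map to
the plane (`log_energy_nonneg`). Hence the energy of such a charge with kernel `Re F` is at most its
logarithmic energy on the circle, which is a sum of `|moment|^2 / k` (`integral_distortion_le`,
`hasSum_circle_energy`).

A complex charge with only negative frequencies pairs with the holomorphic `F` as twice its real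
part pairs with `Re F`, and has the same moments as twice its real part. This turns the real
inequality into a complex quadratic one; polarization and scaling make it bilinear
(`norm_torusPairing_le`).

Cauchy's formula in both variables writes the mixed partial derivative as a pairing of two such
charges (`mixedPartial_eq_torusPairing`). Their energies are dominated by a negative binomial
series, which yields `(2p-1)!` and the power of `r^2 - |z|^2` (`energy_cauchyCharge`). The theorem
follows on the diagonal as `r → 1`. -/

theorem isOpen_unitDisk : IsOpen unitDisk := Metric.isOpen_ball

theorem convex_unitDisk : Convex ℝ unitDisk := convex_ball _ _

theorem mem_unitDisk {z : ℂ} : z ∈ unitDisk ↔ ‖z‖ < 1 := by simp [unitDisk]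

/-! ### Univalent functions, difference quotients and the logarithm -/

/-- An injective holomorphic function on an open set has nonvanishing derivative. -/
theorem deriv_ne_zero_of_injOn {f : ℂ → ℂ} {U : Set ℂ} (hU : IsOpen U)
    (hf : DifferentiableOn ℂ f U) (hinj : InjOn f U) {a : ℂ} (ha : a ∈ U) : deriv f a ≠ 0 := by
  intro h0
  have hder : DifferentiableOn ℂ (deriv f) U := hf.deriv hU
  -- Zeros of `f'` are isolated, as `f` would otherwise be locally constant. Thus for `z ≠ a` near
  -- `a` the function `dslope f z` is zero-free even at `w = z`, and its reciprocal obeys the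
  -- maximum principle.
  have hne : ∀ᶠ z in 𝓝[≠] a, deriv f z ≠ 0 := by
    rcases (hder.analyticAt (hU.mem_nhds ha)).eventually_eq_zero_or_eventually_ne_zero with h | h
    · exfalso
      obtain ⟨ε, hε, hball⟩ := Metric.eventually_nhds_iff_ball.1 (h.and (hU.mem_nhds ha))
      have hz : a + (ε / 2 : ℝ) ∈ Metric.ball a ε := by
        simp [abs_of_pos hε, hε]
      have hconst := (convex_ball a ε).is_const_of_fderivWithin_eq_zero (𝕜 := ℂ) (f := f)
        (hf.mono fun z hz => (hball z hz).2) (fun z hz => by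
          rw [fderivWithin_of_isOpen Metric.isOpen_ball hz]
          ext; simp [(hball z hz).1]) hz (Metric.mem_ball_self hε)
      have := hinj (hball _ hz).2 ha hconst
      simp [hε.ne'] at this
    · exact h
  obtain ⟨ε, hε, hball⟩ := Metric.eventually_nhds_iff_ball.1
    ((eventually_nhdsWithin_iff.1 hne).and (hU.mem_nhds ha))
  set δ := ε / 2 with hδ
  have hδ0 : 0 < δ := by positivity
  have hsub : Metric.closedBall a δ ⊆ U := fun z hz =>
    (hball z (lt_of_le_of_lt (b := δ) hz (by linarith))).2
  have hcont : ContinuousOn (fun w => ‖f w - f a‖) (Metric.sphere a δ) :=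
    ((hf.continuousOn.mono (Metric.sphere_subset_closedBall.trans hsub)).sub
      continuousOn_const).norm
  obtain ⟨w₀, hw₀, hmin⟩ := (isCompact_sphere a δ).exists_isMinOn
    (NormedSpace.sphere_nonempty.2 hδ0.le) hcont
  set m := ‖f w₀ - f a‖ with hm
  have hm0 : 0 < m := by
    rw [hm, norm_pos_iff, sub_ne_zero]
    intro h
    have := hinj (hsub (Metric.sphere_subset_closedBall hw₀)) ha h
    rw [this] at hw₀
    simp at hw₀
    exact hδ0.ne hw₀
  -- for `z` close to `a`, the minimum modulus principle bounds the slope from below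
  have key : ∀ᶠ z in 𝓝[≠] a, m / (4 * δ) ≤ ‖slope f a z‖ := by
    have hfc : ∀ᶠ z in 𝓝 a, ‖f z - f a‖ < m / 2 := by
      have : ContinuousAt f a := (hf.differentiableAt (hU.mem_nhds ha)).continuousAt
      have := Metric.continuousAt_iff.1 this (m / 2) (by positivity)
      obtain ⟨η, hη, h⟩ := this
      filter_upwards [Metric.ball_mem_nhds a hη] with z hz
      simpa [dist_eq_norm] using h hz
    have hzb : ∀ᶠ z in 𝓝 a, z ∈ Metric.ball a δ := Metric.ball_mem_nhds a hδ0
    filter_upwards [nhdsWithin_le_nhds hfc, nhdsWithin_le_nhds hzb, self_mem_nhdsWithin]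
      with z hz1 hz2 hz3
    have hzU : z ∈ U := hsub (Metric.ball_subset_closedBall hz2)
    have hdz : DifferentiableOn ℂ (dslope f z) U :=
      (Complex.differentiableOn_dslope (hU.mem_nhds hzU)).2 hf
    have hnz : ∀ w ∈ Metric.closedBall a δ, dslope f z w ≠ 0 := by
      intro w hw
      by_cases hwz : w = z
      · subst hwz
        rw [dslope_same]
        exact (hball w (lt_of_lt_of_le (b := δ) hz2 (by linarith))).1 hz3
      · rw [dslope_of_ne _ hwz, slope_def_field]
        exact div_ne_zero (sub_ne_zero.2 fun h => hwz (hinj (hsub hw) hzU h)) (sub_ne_zero.2 hwz)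
    have hdi : DiffContOnCl ℂ (fun w => (dslope f z w)⁻¹) (Metric.ball a δ) := by
      apply DifferentiableOn.diffContOnCl
      rw [closure_ball _ hδ0.ne']
      exact (hdz.mono hsub).inv hnz
    have hbd := Complex.norm_le_of_forall_mem_frontier_norm_le (C := 4 * δ / m)
      Metric.isBounded_ball hdi (fun w hw => by
        rw [frontier_ball _ hδ0.ne'] at hw
        have hwz : w ≠ z := by
          rintro rfl
          exact (ne_of_lt hz2) hw
        rw [dslope_of_ne _ hwz, slope_def_field, norm_inv, norm_div, inv_div]
        have h1 : ‖w - z‖ ≤ 2 * δ := by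
          have := dist_triangle w a z
          rw [← dist_eq_norm]
          have h3 : dist w a = δ := hw
          have h4 : dist z a < δ := hz2
          rw [dist_comm a z] at this
          linarith
        have h2 : m / 2 ≤ ‖f w - f z‖ := by
          have h3 : m ≤ ‖f w - f a‖ := hmin hw
          have h4 : ‖f w - f a‖ ≤ ‖f w - f z‖ + ‖f z - f a‖ := by
            simpa using norm_add_le (f w - f z) (f z - f a)
          linarith
        rw [div_le_div_iff₀ (by linarith) hm0]
        nlinarith) (subset_closure (Metric.mem_ball_self hδ0))
    rw [dslope_of_ne _ (Ne.symm hz3), norm_inv] at hbd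
    rw [slope_comm]
    have hpos : 0 < ‖slope f z a‖ := by
      rw [← dslope_of_ne _ (Ne.symm hz3), norm_pos_iff]
      exact hnz a (Metric.mem_closedBall_self hδ0.le)
    rw [inv_le_comm₀ hpos (by positivity), inv_div] at hbd
    exact hbd
  have hlim : Tendsto (fun z => ‖slope f a z‖) (𝓝[≠] a) (𝓝 ‖deriv f a‖) :=
    (hasDerivAt_iff_tendsto_slope.1 (hf.differentiableAt (hU.mem_nhds ha)).hasDerivAt).norm
  have := ge_of_tendsto hlim key
  rw [h0, norm_zero] at this
  have : 0 < m / (4 * δ) := by positivity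
  linarith

theorem dslope_ne_zero_of_injOn {f : ℂ → ℂ} {U : Set ℂ} (hU : IsOpen U)
    (hf : DifferentiableOn ℂ f U) (hinj : InjOn f U) {z w : ℂ} (hz : z ∈ U) (hw : w ∈ U) :
    dslope f z w ≠ 0 := by
  by_cases hwz : w = z
  · subst hwz
    rw [dslope_same]
    exact deriv_ne_zero_of_injOn hU hf hinj hw
  · rw [dslope_of_ne _ hwz, slope_def_field]
    exact div_ne_zero (sub_ne_zero.2 fun h => hwz (hinj hw hz h)) (sub_ne_zero.2 hwz)

theorem dslope_comm (f : ℂ → ℂ) (z w : ℂ) : dslope f z w = dslope f w z := by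
  by_cases hwz : w = z
  · rw [hwz]
  · rw [dslope_of_ne _ hwz, dslope_of_ne _ (Ne.symm hwz), slope_comm]

theorem add_smul_sub_mem {U : Set ℂ} (hconv : Convex ℝ U) {z w : ℂ} (hz : z ∈ U) (hw : w ∈ U)
    {t : ℝ} (ht : t ∈ Icc (0 : ℝ) 1) : z + (t : ℂ) * (w - z) ∈ U := by
  have := hconv.add_smul_sub_mem hz hw ht
  simpa using this

/-- The fundamental theorem of calculus along a segment. The formula has no exceptional case at `w =
z`, so joint holomorphy reduces to differentiation under the integral. -/
theorem dslope_eq_integral {f : ℂ → ℂ} {U : Set ℂ} (hU : IsOpen U) (hconv : Convex ℝ U)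
    (hf : DifferentiableOn ℂ f U) {z w : ℂ} (hz : z ∈ U) (hw : w ∈ U) :
    dslope f z w = ∫ t in (0 : ℝ)..1, deriv f (z + (t : ℂ) * (w - z)) := by
  by_cases hwz : w = z
  · subst hwz
    simp
  · have hd : ContinuousOn (deriv f) U := (hf.deriv hU).continuousOn
    have h := intervalIntegral.integral_unitInterval_deriv_eq_sub (f := f) (f' := deriv f)
      (z₀ := z) (z₁ := w - z) (by
        refine hd.comp (by fun_prop) fun t ht => ?_
        simpa using add_smul_sub_mem hconv hz hw ht)
      (fun t ht => (hf.differentiableAt (hU.mem_nhds (by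
        simpa using add_smul_sub_mem hconv hz hw ht))).hasDerivAt)
    rw [dslope_of_ne _ hwz, slope_def_field, eq_comm, eq_div_iff (sub_ne_zero.2 hwz), mul_comm]
    simpa using h

/-- The difference quotient of a holomorphic function is jointly holomorphic. -/
theorem differentiableOn_dslope_prod {f : ℂ → ℂ} {U : Set ℂ} (hU : IsOpen U)
    (hconv : Convex ℝ U) (hf : DifferentiableOn ℂ f U) :
    DifferentiableOn ℂ (fun x : ℂ × ℂ => dslope f x.1 x.2) (U ×ˢ U) := by
  intro x₀ hx₀
  have hUU : IsOpen (U ×ˢ U) := hU.prod hU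
  obtain ⟨ε, hε, hball⟩ := Metric.nhds_basis_closedBall.mem_iff.1 (hUU.mem_nhds hx₀)
  set φ : ℂ × ℂ → ℝ → ℂ := fun x t => x.1 + (t : ℂ) * (x.2 - x.1) with hφ
  have hφU : ∀ x ∈ U ×ˢ U, ∀ t ∈ Icc (0 : ℝ) 1, φ x t ∈ U := fun x hx t ht =>
    add_smul_sub_mem hconv hx.1 hx.2 ht
  set L : ℝ → ℂ × ℂ →L[ℂ] ℂ := fun t => ContinuousLinearMap.fst ℂ ℂ ℂ +
    (t : ℂ) • (ContinuousLinearMap.snd ℂ ℂ ℂ - ContinuousLinearMap.fst ℂ ℂ ℂ) with hL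
  have hLc : Continuous L := by fun_prop
  have hφd : ∀ x t, HasFDerivAt (fun y => φ y t) (L t) x := by
    intro x t
    exact hasFDerivAt_fst.add ((hasFDerivAt_snd.sub hasFDerivAt_fst).const_mul _)
  have hd1 : DifferentiableOn ℂ (deriv f) U := hf.deriv hU
  have hd2 : DifferentiableOn ℂ (deriv (deriv f)) U := hd1.deriv hU
  have hφc : Continuous (fun y : (ℂ × ℂ) × ℝ => φ y.1 y.2) := by fun_prop
  have hcomp : IsCompact (Metric.closedBall x₀ ε ×ˢ Icc (0 : ℝ) 1) :=
    (isCompact_closedBall x₀ ε).prod isCompact_Icc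
  obtain ⟨C, hC⟩ := hcomp.exists_bound_of_continuousOn
    (f := fun y : (ℂ × ℂ) × ℝ => deriv (deriv f) (φ y.1 y.2) • L y.2) (by
      refine ContinuousOn.smul (hd2.continuousOn.comp hφc.continuousOn fun y hy => ?_)
        (by fun_prop)
      exact hφU _ (hball hy.1) _ hy.2)
  have hIoc : ∀ t ∈ Ioc (0 : ℝ) 1, t ∈ Icc (0 : ℝ) 1 := fun t ht => ⟨ht.1.le, ht.2⟩
  have hmeas : ∀ {G : Type} [NormedAddCommGroup G] {g : ℝ → G}, ContinuousOn g (Icc 0 1) →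
      Integrable g (volume.restrict (Ioc (0 : ℝ) 1)) := fun hg =>
    (hg.integrableOn_compact isCompact_Icc).mono_set Ioc_subset_Icc_self
  have hFc : ∀ x ∈ U ×ˢ U, ContinuousOn (fun t => deriv f (φ x t)) (Icc 0 1) := fun x hx =>
    hd1.continuousOn.comp (by fun_prop) fun t ht => hφU x hx t ht
  have main := hasFDerivAt_integral_of_dominated_of_fderiv_le (𝕜 := ℂ)
    (μ := volume.restrict (Ioc (0 : ℝ) 1)) (F := fun x t => deriv f (φ x t))
    (F' := fun x t => deriv (deriv f) (φ x t) • L t) (x₀ := x₀) (bound := fun _ => C)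
    (Metric.closedBall_mem_nhds x₀ hε)
    (by
      filter_upwards [hUU.mem_nhds hx₀] with x hx
      exact (hmeas (hFc x hx)).aestronglyMeasurable)
    (hmeas (hFc x₀ hx₀))
    (hmeas ((hd2.continuousOn.comp (by fun_prop) fun t ht => hφU x₀ hx₀ t ht).smul
      hLc.continuousOn)).aestronglyMeasurable
    (by
      refine (ae_restrict_iff' measurableSet_Ioc).2 (Eventually.of_forall fun t ht x hx => ?_)
      exact hC (x, t) ⟨hx, hIoc t ht⟩)
    (integrable_const C)
    (by
      refine (ae_restrict_iff' measurableSet_Ioc).2 (Eventually.of_forall fun t ht x hx => ?_)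
      have h := (hd1.differentiableAt
        (hU.mem_nhds (hφU x (hball hx) t (hIoc t ht)))).hasDerivAt
      exact h.comp_hasFDerivAt x (hφd x t))
  refine (main.congr_of_eventuallyEq ?_).differentiableAt.differentiableWithinAt
  filter_upwards [hUU.mem_nhds hx₀] with x hx
  rw [dslope_eq_integral hU hconv hf hx.1 hx.2, intervalIntegral.integral_of_le zero_le_one]

/-- A continuous logarithm of a differentiable function is differentiable. -/
theorem differentiableAt_of_exp_eq {E : Type*} [NormedAddCommGroup E] [NormedSpace ℂ E]
    {F Q : E → ℂ} {x : E} (hF : ContinuousAt F x) (hQ : DifferentiableAt ℂ Q x)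
    (h : ∀ᶠ y in 𝓝 x, Complex.exp (F y) = Q y) : DifferentiableAt ℂ F x := by
  -- Dividing by `Q x` brings the argument close to `1`, away from the cut of the principal
  -- logarithm.
  have hlog : DifferentiableAt ℂ (fun y => F x + Complex.log (Q y * (Q x)⁻¹)) x := by
    refine (DifferentiableAt.clog (hQ.mul_const _) ?_).const_add _
    have : Q x ≠ 0 := by
      rw [← h.self_of_nhds]; exact Complex.exp_ne_zero _
    simp [this]
  refine hlog.congr_of_eventuallyEq ?_
  have him : ContinuousAt (fun y => (F y - F x).im) x :=
    Complex.continuous_im.continuousAt.comp (hF.sub continuousAt_const)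
  have h1 : ∀ᶠ y in 𝓝 x, (F y - F x).im ∈ Ioo (-Real.pi) Real.pi :=
    him.eventually (isOpen_Ioo.mem_nhds (by simp [Real.pi_pos]))
  filter_upwards [h, h1] with y hy1 hy2
  rw [← hy1, ← h.self_of_nhds, ← div_eq_mul_inv, ← Complex.exp_sub, Complex.log_exp hy2.1 hy2.2.le]
  ring

/-- The quotient has no zeros on the bidisk, which is convex and so simply connected; hence it has a
continuous logarithm, which is automatically holomorphic. Its value at the origin can be subtracted
because the quotient equals `f' 0 = 1` there. -/
theorem exists_isLogBranch {f : ℂ → ℂ} (hf : IsClassS f) : ∃ F, IsLogBranch f F := by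
  have h0 : (0 : ℂ) ∈ unitDisk := by simp [unitDisk]
  have hopen : IsOpen (unitDisk ×ˢ unitDisk) := isOpen_unitDisk.prod isOpen_unitDisk
  have hconv : Convex ℝ (unitDisk ×ˢ unitDisk) := convex_unitDisk.prod convex_unitDisk
  have hne : ∀ z ∈ unitDisk, ∀ w ∈ unitDisk, dslope f z w ≠ 0 := fun z hz w hw =>
    dslope_ne_zero_of_injOn isOpen_unitDisk hf.analytic hf.injective hz hw
  have hd0 : DifferentiableOn ℂ (dslope f 0) unitDisk :=
    (Complex.differentiableOn_dslope (isOpen_unitDisk.mem_nhds h0)).2 hf.analytic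
  set Q : ℂ × ℂ → ℂ := fun x => quotient f x.1 x.2 with hQ
  have hQd : DifferentiableOn ℂ Q (unitDisk ×ˢ unitDisk) := by
    refine ((differentiableOn_dslope_prod isOpen_unitDisk convex_unitDisk hf.analytic).mul
      ?_).mul ?_
    · exact (hd0.comp differentiableOn_fst fun x hx => hx.1).inv fun x hx => hne 0 h0 _ hx.1
    · exact (hd0.comp differentiableOn_snd fun x hx => hx.2).inv fun x hx => hne 0 h0 _ hx.2
  have hQ0 : ∀ x ∈ unitDisk ×ˢ unitDisk, Q x ≠ 0 := fun x hx =>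
    mul_ne_zero (mul_ne_zero (hne _ hx.1 _ hx.2) (inv_ne_zero (hne 0 h0 _ hx.1)))
      (inv_ne_zero (hne 0 h0 _ hx.2))
  have hsc : IsSimplyConnected (unitDisk ×ˢ unitDisk) := by
    have := hconv.contractibleSpace ⟨(0, 0), h0, h0⟩
    exact SimplyConnectedSpace.ofContractible _
  obtain ⟨G, hGc, hG⟩ := Complex.exists_continuousOn_eqOn_exp_comp hsc hopen hQd.continuousOn
    (by rintro ⟨x, hx, h⟩; exact hQ0 x hx h)
  have hQ00 : Complex.exp (G (0, 0)) = 1 := by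
    have := hG (x := (0, 0)) ⟨h0, h0⟩
    simpa [hQ, quotient, hf.deriv_zero] using this
  refine ⟨fun x => G x - G (0, 0), ?_, ?_, by simp⟩
  · intro x hx
    refine (DifferentiableAt.sub_const ?_ _).differentiableWithinAt
    refine differentiableAt_of_exp_eq (hGc.continuousAt (hopen.mem_nhds hx))
      (hQd.differentiableAt (hopen.mem_nhds hx)) ?_
    filter_upwards [hopen.mem_nhds hx] with y hy using hG hy
  · intro z hz w hw
    rw [Complex.exp_sub, hQ00, div_one]
    exact hG (x := (z, w)) ⟨hz, hw⟩

/-! ### Integration over the circle and the torus -/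

/-- Lebesgue measure on `(0, 2π]`, the parameter interval of the unit circle. -/
noncomputable abbrev arcMeasure : Measure ℝ := volume.restrict (Ioc 0 (2 * Real.pi))

/-- The parametrization `t ↦ exp (i t)` of the unit circle. -/
noncomputable def unitExp (t : ℝ) : ℂ := Complex.exp (t * Complex.I)

@[fun_prop]
theorem continuous_unitExp : Continuous unitExp := by unfold unitExp; fun_prop

@[simp]
theorem norm_unitExp (t : ℝ) : ‖unitExp t‖ = 1 := Complex.norm_exp_ofReal_mul_I t

theorem unitExp_ne_zero (t : ℝ) : unitExp t ≠ 0 := Complex.exp_ne_zero _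

theorem conj_unitExp (t : ℝ) : (starRingEnd ℂ) (unitExp t) = (unitExp t)⁻¹ := by
  rw [Complex.inv_def]
  simp [Complex.normSq_eq_norm_sq]

theorem arcMeasure_prod : arcMeasure.prod arcMeasure =
    (volume : Measure (ℝ × ℝ)).restrict (Ioc 0 (2 * Real.pi) ×ˢ Ioc 0 (2 * Real.pi)) := by
  rw [Measure.prod_restrict, Measure.volume_eq_prod]

theorem ae_arcMeasure_prod {P : ℝ × ℝ → Prop}
    (h : ∀ y ∈ Icc 0 (2 * Real.pi) ×ˢ Icc 0 (2 * Real.pi), P y) :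
    ∀ᵐ y ∂(arcMeasure.prod arcMeasure), P y := by
  rw [arcMeasure_prod]
  refine (ae_restrict_iff' (measurableSet_Ioc.prod measurableSet_Ioc)).2
    (Eventually.of_forall fun y hy => h y ?_)
  exact ⟨Ioc_subset_Icc_self hy.1, Ioc_subset_Icc_self hy.2⟩

theorem _root_.Continuous.integrable_arcMeasure {G : Type*} [NormedAddCommGroup G] {g : ℝ → G}
    (hg : Continuous g) : Integrable g arcMeasure :=
  (hg.continuousOn.integrableOn_compact isCompact_Icc).mono_set Ioc_subset_Icc_self

theorem _root_.Continuous.integrable_arcMeasure_prod {G : Type*} [NormedAddCommGroup G]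
    {g : ℝ × ℝ → G} (hg : Continuous g) : Integrable g (arcMeasure.prod arcMeasure) := by
  rw [arcMeasure_prod]
  exact (hg.continuousOn.integrableOn_compact (isCompact_Icc.prod isCompact_Icc)).mono_set
    (prod_mono Ioc_subset_Icc_self Ioc_subset_Icc_self)

theorem exists_bound_arcMeasure_prod {G : Type*} [NormedAddCommGroup G] {g : ℝ × ℝ → G}
    (hg : Continuous g) : ∃ C, ∀ᵐ y ∂(arcMeasure.prod arcMeasure), ‖g y‖ ≤ C := by
  obtain ⟨C, hC⟩ := (isCompact_Icc.prod isCompact_Icc).exists_bound_of_continuousOn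
    (s := Icc 0 (2 * Real.pi) ×ˢ Icc 0 (2 * Real.pi)) hg.continuousOn
  exact ⟨C, ae_arcMeasure_prod hC⟩

/-- Uniformly geometrically dominated series can be integrated term by term. -/
theorem hasSum_integral_of_geometric_bound {𝕜 : Type*} [RCLike 𝕜] {g : ℕ → ℝ × ℝ → 𝕜}
    {s w : ℝ × ℝ → 𝕜}
    (hg : ∀ n, Continuous (g n)) (hw : Continuous w) {a : ℝ} (ha0 : 0 ≤ a) (ha1 : a < 1)
    (hbound : ∀ n, ∀ᵐ y ∂(arcMeasure.prod arcMeasure), ‖g n y‖ ≤ a ^ n)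
    (hsum : ∀ᵐ y ∂(arcMeasure.prod arcMeasure), HasSum (fun n => g n y) (s y)) :
    HasSum (fun n => ∫ y, g n y * w y ∂(arcMeasure.prod arcMeasure))
      (∫ y, s y * w y ∂(arcMeasure.prod arcMeasure)) := by
  obtain ⟨C, hC⟩ := exists_bound_arcMeasure_prod hw
  refine hasSum_integral_of_dominated_convergence (fun n _ => a ^ n * C)
    (fun n => ((hg n).mul hw).aestronglyMeasurable) (fun n => ?_)
    (Eventually.of_forall fun y => (summable_geometric_of_lt_one ha0 ha1).mul_right C)
    (integrable_const _) ?_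
  · filter_upwards [hbound n, hC] with y h1 h2
    rw [norm_mul]
    exact mul_le_mul h1 h2 (norm_nonneg _) (by positivity)
  · filter_upwards [hsum] with y hy using hy.mul_right _

/-! ### Positivity of the logarithmic energy -/

/-- Powers of a Gram kernel are positive semidefinite. -/
theorem integral_gram_pow_nonneg {ι : Type*} [Fintype ι] {v : ι → ℝ → ℝ}
    (hv : ∀ i, Continuous (v i)) {x : ℝ → ℝ} (hx : Continuous x) (n : ℕ) :
    0 ≤ ∫ y, (∑ i, v i y.1 * v i y.2) ^ n * (x y.1 * x y.2) ∂(arcMeasure.prod arcMeasure) := by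
  -- The `n`-th power is again a Gram kernel, indexed by `Fin n → ι`, so that each summand
  -- integrates to a square.
  have h : ∀ y : ℝ × ℝ, (∑ i, v i y.1 * v i y.2) ^ n * (x y.1 * x y.2) =
      ∑ p : Fin n → ι, ((∏ j, v (p j) y.1) * x y.1) * ((∏ j, v (p j) y.2) * x y.2) := by
    intro y
    rw [Fintype.sum_pow, Finset.sum_mul]
    refine Finset.sum_congr rfl fun p _ => ?_
    rw [Finset.prod_mul_distrib]
    ring
  simp_rw [h]
  rw [integral_finsetSum]
  · refine Finset.sum_nonneg fun p _ => ?_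
    rw [integral_prod_mul (fun t => (∏ j, v (p j) t) * x t) (fun t => (∏ j, v (p j) t) * x t)]
    exact mul_self_nonneg _
  · intro p _
    exact Continuous.integrable_arcMeasure_prod (by fun_prop)

/-- Fubini splits off the factor `∫ x = 0`. Terms of a kernel that depend on one variable only can
therefore be discarded. -/
theorem integral_mul_fst_eq_zero {𝕜 : Type*} [RCLike 𝕜] {x : ℝ → 𝕜}
    (hx0 : ∫ t, x t ∂arcMeasure = 0) (g : ℝ → 𝕜) :
    ∫ y, g y.1 * (x y.1 * x y.2) ∂(arcMeasure.prod arcMeasure) = 0 := by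
  simp_rw [← mul_assoc]
  rw [integral_prod_mul (fun t => g t * x t) x, hx0, mul_zero]

theorem integral_mul_snd_eq_zero {𝕜 : Type*} [RCLike 𝕜] {x : ℝ → 𝕜}
    (hx0 : ∫ t, x t ∂arcMeasure = 0) (g : ℝ → 𝕜) :
    ∫ y, g y.2 * (x y.1 * x y.2) ∂(arcMeasure.prod arcMeasure) = 0 := by
  simp_rw [mul_left_comm]
  rw [integral_prod_mul x (fun t => g t * x t), hx0, zero_mul]

/-- The coordinates of the (perturbed) stereographic projection to the sphere. -/
noncomputable def sphereCoord (ε : ℝ) (a : ℂ) : Fin 4 → ℝ :=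
  ![√(1 - ε) / (1 + ‖a‖ ^ 2), ‖a‖ ^ 2 / (1 + ‖a‖ ^ 2), √2 * a.re / (1 + ‖a‖ ^ 2),
    √2 * a.im / (1 + ‖a‖ ^ 2)]

/-- For `ε = 0` the vectors have length one and this is half the squared chordal distance; the
factor `√(1 - ε)` in the first coordinate adds `ε` to the numerator. So the regularized logarithmic
kernel is `log (1 - k)`, with `k` a Gram kernel, up to functions of one variable. -/
theorem one_sub_sum_sphereCoord {ε : ℝ} (hε : ε ≤ 1) (a b : ℂ) :
    1 - ∑ i, sphereCoord ε a i * sphereCoord ε b i =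
      (‖a - b‖ ^ 2 + ε) / ((1 + ‖a‖ ^ 2) * (1 + ‖b‖ ^ 2)) := by
  have h1 : √(1 - ε) * √(1 - ε) = 1 - ε := Real.mul_self_sqrt (by linarith)
  have h2 : √2 * √2 = (2 : ℝ) := Real.mul_self_sqrt (by norm_num)
  have ha : 1 + ‖a‖ ^ 2 ≠ 0 := by positivity
  have hb : 1 + ‖b‖ ^ 2 ≠ 0 := by positivity
  simp only [sphereCoord, Fin.sum_univ_four, Matrix.cons_val]
  rw [eq_div_iff (mul_ne_zero ha hb)]
  have e : (1 - (√(1 - ε) / (1 + ‖a‖ ^ 2) * (√(1 - ε) / (1 + ‖b‖ ^ 2)) +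
      ‖a‖ ^ 2 / (1 + ‖a‖ ^ 2) * (‖b‖ ^ 2 / (1 + ‖b‖ ^ 2)) +
      √2 * a.re / (1 + ‖a‖ ^ 2) * (√2 * b.re / (1 + ‖b‖ ^ 2)) +
      √2 * a.im / (1 + ‖a‖ ^ 2) * (√2 * b.im / (1 + ‖b‖ ^ 2)))) *
      ((1 + ‖a‖ ^ 2) * (1 + ‖b‖ ^ 2)) = (1 + ‖a‖ ^ 2) * (1 + ‖b‖ ^ 2) -
      (√(1 - ε) * √(1 - ε) + ‖a‖ ^ 2 * ‖b‖ ^ 2 + (√2 * √2) * (a.re * b.re + a.im * b.im)) := by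
    field_simp
    ring
  rw [e, h1, h2]
  simp only [← Complex.normSq_eq_norm_sq, Complex.normSq_apply, Complex.sub_re, Complex.sub_im]
  ring

/-- A uniform gap below `1` makes the series of `-log (1 - k)` converge geometrically. -/
theorem abs_sum_sphereCoord_le {ε M : ℝ} (hε0 : 0 < ε) (hε : ε ≤ 1) {a b : ℂ} (ha : ‖a‖ ≤ M)
    (hb : ‖b‖ ≤ M) : |∑ i, sphereCoord ε a i * sphereCoord ε b i| ≤ 1 - ε / (1 + M ^ 2) ^ 2 := by
  have hsub := one_sub_sum_sphereCoord hε a b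
  set k := ∑ i, sphereCoord ε a i * sphereCoord ε b i
  set D := (1 + ‖a‖ ^ 2) * (1 + ‖b‖ ^ 2) with hD
  have hD0 : 0 < D := by positivity
  have hDM : D ≤ (1 + M ^ 2) ^ 2 := by
    rw [hD, sq (1 + M ^ 2)]
    gcongr
  have hle : ε / (1 + M ^ 2) ^ 2 ≤ ε / D := by gcongr
  have h1 : ε / D ≤ 1 - k := by
    rw [hsub]
    gcongr
    nlinarith [sq_nonneg ‖a - b‖]
  have h2 : ε / D ≤ 1 + k := by
    have : 1 + k = (2 - ε + 2 * (‖a‖ ^ 2 * ‖b‖ ^ 2) + ‖a + b‖ ^ 2) / D := by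
      have : 1 + k = (2 * D - (‖a - b‖ ^ 2 + ε)) / D := by
        rw [sub_div, ← hsub]
        field_simp
        ring
      rw [this, hD]
      congr 1
      simp only [← Complex.normSq_eq_norm_sq, Complex.normSq_apply, Complex.sub_re,
        Complex.sub_im, Complex.add_re, Complex.add_im]
      ring
    rw [this]
    gcongr
    have : 0 ≤ ‖a‖ ^ 2 * ‖b‖ ^ 2 := by positivity
    nlinarith [sq_nonneg ‖a + b‖]
  rw [abs_le]
  constructor <;> linarith

/-- The regularized logarithmic energy of a charge of total mass zero is nonnegative. -/
theorem log_energy_nonneg {h : ℝ → ℂ} (hh : Continuous h) {x : ℝ → ℝ} (hx : Continuous x)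
    (hx0 : ∫ t, x t ∂arcMeasure = 0) {ε : ℝ} (hε0 : 0 < ε) (hε : ε ≤ 1) :
    0 ≤ -∫ y, Real.log (‖h y.1 - h y.2‖ ^ 2 + ε) * (x y.1 * x y.2)
      ∂(arcMeasure.prod arcMeasure) := by
  obtain ⟨M, hM⟩ := isCompact_Icc.exists_bound_of_continuousOn
    (s := Icc 0 (2 * Real.pi)) hh.continuousOn
  have hM0 : 0 ≤ M := (norm_nonneg _).trans (hM 0 ⟨le_rfl, by positivity⟩)
  set k : ℝ × ℝ → ℝ := fun y => ∑ i, sphereCoord ε (h y.1) i * sphereCoord ε (h y.2) i with hk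
  have hv : ∀ i, Continuous fun t => sphereCoord ε (h t) i := by
    have hne : ∀ t, 1 + ‖h t‖ ^ 2 ≠ 0 := fun t => by positivity
    have hre : Continuous fun t => (h t).re := Complex.continuous_re.comp hh
    have him : Continuous fun t => (h t).im := Complex.continuous_im.comp hh
    intro i
    fin_cases i <;> simp only [sphereCoord, Fin.reduceFinMk, Fin.zero_eta, Fin.mk_one,
      Matrix.cons_val] <;> exact Continuous.div (by fun_prop) (by fun_prop) hne
  have hkc : Continuous k := by
    refine continuous_finsetSum _ fun i _ => ?_
    exact ((hv i).comp continuous_fst).mul ((hv i).comp continuous_snd)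
  set a : ℝ := 1 - ε / (1 + M ^ 2) ^ 2
  have hka : ∀ᵐ y ∂(arcMeasure.prod arcMeasure), |k y| ≤ a := ae_arcMeasure_prod fun y hy =>
    abs_sum_sphereCoord_le hε0 hε (hM _ hy.1) (hM _ hy.2)
  have ha1 : a < 1 := by
    have : 0 < ε / (1 + M ^ 2) ^ 2 := by positivity
    simp only [a]; linarith
  have ha0 : 0 ≤ a := (abs_nonneg _).trans
    (abs_sum_sphereCoord_le hε0 hε (hM 0 ⟨le_rfl, by positivity⟩) (hM 0 ⟨le_rfl, by positivity⟩))
  -- The series of `-log (1 - k)` has positive coefficients, and each power of `k` has nonnegative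
  -- energy.
  have hsum := hasSum_integral_of_geometric_bound (g := fun n y => k y ^ (n + 1) / ((n : ℝ) + 1))
    (s := fun y => -Real.log (1 - k y)) (w := fun y => x y.1 * x y.2)
    (fun n => (hkc.pow _).div_const _) (by fun_prop) ha0 ha1 (fun n => by
      filter_upwards [hka] with y hy
      rw [norm_div, norm_pow, Real.norm_eq_abs, Real.norm_eq_abs]
      have h1 : |k y| ^ (n + 1) ≤ a ^ n := calc
        |k y| ^ (n + 1) ≤ a ^ (n + 1) := by gcongr
        _ ≤ a ^ n := pow_le_pow_of_le_one ha0 ha1.le (Nat.le_succ n)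
      refine (div_le_self (by positivity) ?_).trans h1
      rw [abs_of_nonneg (by positivity)]
      linarith [Nat.cast_nonneg (α := ℝ) n])
    (by
      filter_upwards [hka] with y hy
      exact Real.hasSum_pow_div_log_of_abs_lt_one (hy.trans_lt ha1))
  have hnn : 0 ≤ ∫ y, -Real.log (1 - k y) * (x y.1 * x y.2) ∂(arcMeasure.prod arcMeasure) := by
    refine hsum.nonneg fun n => ?_
    have := integral_gram_pow_nonneg hv hx (n + 1)
    have h2 : ∀ y : ℝ × ℝ, k y ^ (n + 1) / ((n : ℝ) + 1) * (x y.1 * x y.2) =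
        ((n : ℝ) + 1)⁻¹ * (k y ^ (n + 1) * (x y.1 * x y.2)) := fun y => by ring
    simp_rw [h2]
    rw [integral_const_mul]
    exact mul_nonneg (by positivity) this
  set l : ℝ → ℝ := fun t => Real.log (1 + ‖h t‖ ^ 2) with hl
  have hlc : Continuous l := Continuous.log (by fun_prop) fun t => by positivity
  have hLc : Continuous fun y : ℝ × ℝ => Real.log (‖h y.1 - h y.2‖ ^ 2 + ε) :=
    Continuous.log (by fun_prop) fun y => by positivity
  have hpt : ∀ y : ℝ × ℝ, -Real.log (1 - k y) * (x y.1 * x y.2) =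
      (l y.1 * (x y.1 * x y.2) + l y.2 * (x y.1 * x y.2)) -
        Real.log (‖h y.1 - h y.2‖ ^ 2 + ε) * (x y.1 * x y.2) := by
    intro y
    simp only [hk]
    rw [one_sub_sum_sphereCoord hε, Real.log_div (by positivity) (by positivity),
      Real.log_mul (by positivity) (by positivity)]
    ring
  simp_rw [hpt] at hnn
  rw [integral_sub (Continuous.integrable_arcMeasure_prod (by fun_prop))
    (Continuous.integrable_arcMeasure_prod (by fun_prop)),
    integral_add (Continuous.integrable_arcMeasure_prod (by fun_prop))
    (Continuous.integrable_arcMeasure_prod (by fun_prop)), integral_mul_fst_eq_zero hx0,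
    integral_mul_snd_eq_zero hx0] at hnn
  linarith

/-! ### Energy on the circle and its comparison with the image curve -/

/-- The moments of a charge on the circle. -/
noncomputable def moment (x : ℝ → ℂ) (k : ℕ) : ℂ := ∫ t, unitExp t ^ k * x t ∂arcMeasure

/-- This identity dictates the regularization `ε = (1 - ρ)^2 / ρ`: the logarithm of the right side
is, up to a constant, the real part of a power series in `ρ`. -/
theorem norm_unitExp_sub_sq {ρ : ℝ} (hρ : 0 < ρ) (t s : ℝ) :
    ‖unitExp t - unitExp s‖ ^ 2 + (1 - ρ) ^ 2 / ρ =
      ‖1 - ρ * (unitExp t * (starRingEnd ℂ) (unitExp s))‖ ^ 2 / ρ := by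
  have h1 : (unitExp t).re ^ 2 + (unitExp t).im ^ 2 = 1 := by
    have := Complex.normSq_eq_norm_sq (unitExp t)
    rw [norm_unitExp, Complex.normSq_apply] at this
    linarith
  have h2 : (unitExp s).re ^ 2 + (unitExp s).im ^ 2 = 1 := by
    have := Complex.normSq_eq_norm_sq (unitExp s)
    rw [norm_unitExp, Complex.normSq_apply] at this
    linarith
  rw [eq_div_iff hρ.ne', add_mul, div_mul_cancel₀ _ hρ.ne']
  simp only [← Complex.normSq_eq_norm_sq, Complex.normSq_apply, Complex.sub_re, Complex.sub_im,
    Complex.mul_re, Complex.mul_im, Complex.conj_re, Complex.conj_im, Complex.ofReal_re,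
    Complex.ofReal_im, Complex.one_re, Complex.one_im]
  set p := (unitExp t).re
  set q := (unitExp t).im
  set p' := (unitExp s).re
  set q' := (unitExp s).im
  linear_combination (ρ - ρ ^ 2 * (p' ^ 2 + q' ^ 2)) * h1 + (ρ - ρ ^ 2) * h2

/-- The regularized logarithmic energy of a charge on the unit circle, in terms of moments. -/
theorem hasSum_circle_energy {x : ℝ → ℝ} (hx : Continuous x) (hx0 : ∫ t, x t ∂arcMeasure = 0)
    {ρ : ℝ} (hρ0 : 0 < ρ) (hρ1 : ρ < 1) :
    HasSum (fun k : ℕ => ρ ^ k * (2 * (‖moment (fun t => x t) k‖ ^ 2 / k)))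
      (-∫ y, Real.log (‖unitExp y.1 - unitExp y.2‖ ^ 2 + (1 - ρ) ^ 2 / ρ) * (x y.1 * x y.2)
        ∂(arcMeasure.prod arcMeasure)) := by
  set ζ : ℝ × ℝ → ℂ := fun y => ρ * (unitExp y.1 * (starRingEnd ℂ) (unitExp y.2)) with hζ
  have hζc : Continuous ζ := by
    have : Continuous fun y : ℝ × ℝ => (starRingEnd ℂ) (unitExp y.2) :=
      Complex.continuous_conj.comp (by fun_prop)
    fun_prop
  have hζn : ∀ y, ‖ζ y‖ = ρ := fun y => by simp [hζ, abs_of_pos hρ0]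
  have hζ1 : ∀ y, 1 - ζ y ≠ 0 := fun y h => by
    have := hζn y
    rw [← sub_eq_zero.1 h, norm_one] at this
    linarith
  -- The term `n = 0` is zero, since division by zero gives zero.
  have hsum := hasSum_integral_of_geometric_bound (g := fun n y => ζ y ^ n / (n : ℂ))
    (s := fun y => -Complex.log (1 - ζ y)) (w := fun y => (x y.1 : ℂ) * (x y.2 : ℂ))
    (fun n => (hζc.pow _).div_const _) (by fun_prop) hρ0.le hρ1 (fun n => by
      refine Eventually.of_forall fun y => ?_
      rw [norm_div, norm_pow, hζn, Complex.norm_natCast]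
      rcases Nat.eq_zero_or_pos n with rfl | hn
      · simp
      · exact div_le_self (by positivity) (by exact_mod_cast hn))
    (Eventually.of_forall fun y => Complex.hasSum_taylorSeries_neg_log (by rw [hζn]; exact hρ1))
  have hterm : ∀ n : ℕ, ∫ y, ζ y ^ n / (n : ℂ) * ((x y.1 : ℂ) * (x y.2 : ℂ))
      ∂(arcMeasure.prod arcMeasure) = ((ρ ^ n * (‖moment (fun t => x t) n‖ ^ 2 / n) : ℝ) : ℂ) := by
    intro n
    have h1 : ∀ y : ℝ × ℝ, ζ y ^ n / (n : ℂ) * ((x y.1 : ℂ) * (x y.2 : ℂ)) =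
        ((ρ : ℂ) ^ n / n) * ((unitExp y.1 ^ n * x y.1) *
          (starRingEnd ℂ) (unitExp y.2 ^ n * x y.2)) := by
      intro y
      simp only [hζ, map_mul, map_pow, Complex.conj_ofReal]
      ring
    simp_rw [h1]
    rw [integral_const_mul, integral_prod_mul (fun t => unitExp t ^ n * x t)
      (fun t => (starRingEnd ℂ) (unitExp t ^ n * x t)), integral_conj, Complex.mul_conj,
      Complex.normSq_eq_norm_sq]
    push_cast [moment]
    ring
  simp_rw [hterm] at hsum
  have hre := Complex.hasSum_re hsum
  simp only [Complex.ofReal_re] at hre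
  have hclog : Continuous fun y => Complex.log (1 - ζ y) := by
    refine Continuous.clog (by fun_prop) fun y => ?_
    left
    have := (Complex.re_le_norm (ζ y)).trans_lt ((hζn y).trans_lt hρ1)
    simp only [Complex.sub_re, Complex.one_re]
    linarith
  have hint : (∫ y, -Complex.log (1 - ζ y) * ((x y.1 : ℂ) * (x y.2 : ℂ))
      ∂(arcMeasure.prod arcMeasure)).re =
      ∫ y, -Real.log ‖1 - ζ y‖ * (x y.1 * x y.2) ∂(arcMeasure.prod arcMeasure) := by
    rw [← RCLike.re_eq_complex_re, ← integral_re
      (Continuous.integrable_arcMeasure_prod (by fun_prop))]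
    congr 1
    ext y
    rw [← Complex.ofReal_mul, RCLike.re_eq_complex_re, Complex.re_mul_ofReal, Complex.neg_re,
      Complex.log_re]
  rw [hint] at hre
  have hpt : ∀ y : ℝ × ℝ, Real.log (‖unitExp y.1 - unitExp y.2‖ ^ 2 + (1 - ρ) ^ 2 / ρ) *
      (x y.1 * x y.2) = (-2) * (-Real.log ‖1 - ζ y‖ * (x y.1 * x y.2)) -
        Real.log ρ * (x y.1 * x y.2) := by
    intro y
    rw [norm_unitExp_sub_sq hρ0, Real.log_div _ hρ0.ne', Real.log_pow]
    · push_cast; ring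
    · exact pow_ne_zero 2 (norm_ne_zero_iff.2 (hζ1 y))
  have hlogc : Continuous fun y => Real.log ‖1 - ζ y‖ :=
    Continuous.log (by fun_prop) fun y => norm_ne_zero_iff.2 (hζ1 y)
  simp_rw [hpt]
  rw [integral_sub (Continuous.integrable_arcMeasure_prod (by fun_prop))
    (Continuous.integrable_arcMeasure_prod (by fun_prop)),
    integral_mul_fst_eq_zero hx0 (fun _ => Real.log ρ), integral_const_mul]
  rw [sub_zero, neg_mul, neg_neg]
  simpa only [mul_left_comm (2 : ℝ)] using hre.mul_left 2

theorem unitExp_injOn : InjOn unitExp (Ioc 0 (2 * Real.pi)) := by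
  intro s hs t ht h
  unfold unitExp at h
  obtain ⟨n, hn⟩ := Complex.exp_eq_exp_iff_exists_int.1 h
  have h1 : s = t + n * (2 * Real.pi) := by
    have := congrArg Complex.im hn
    simpa using this
  have hpi := Real.pi_pos
  have hlt : (n : ℝ) < 1 := by
    by_contra! hc
    nlinarith [hs.2, ht.1]
  have hgt : (-1 : ℝ) < n := by
    by_contra! hc
    nlinarith [hs.1, ht.2]
  have : n = 0 := by
    have h2 : n < 1 := by exact_mod_cast hlt
    have h3 : -1 < n := by exact_mod_cast hgt
    omega
  rw [h1, this]
  simp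

theorem ae_unitExp_ne :
    ∀ᵐ y ∂(arcMeasure.prod arcMeasure), unitExp y.1 ≠ unitExp y.2 := by
  have hmeas : MeasurableSet {y : ℝ × ℝ | unitExp y.1 ≠ unitExp y.2} :=
    (isOpen_ne_fun (by fun_prop) (by fun_prop)).measurableSet
  rw [Measure.ae_prod_iff_ae_ae hmeas]
  refine (ae_restrict_iff' measurableSet_Ioc).2 (Eventually.of_forall fun t ht => ?_)
  refine (ae_restrict_iff' measurableSet_Ioc).2 ?_
  have : ∀ᵐ s : ℝ, s ≠ t := by simp [ae_iff]
  filter_upwards [this] with s hs hs' heq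
  exact hs (unitExp_injOn hs' ht heq.symm)

/-- Multiplying `τ` by `exp φ` changes `τ + ε` by a factor between `exp (-|φ|)` and `exp |φ|`. The
bound does not depend on `ε`, so it dominates the limit `ε → 0`. -/
theorem abs_log_div_le {τ φ ε : ℝ} (hτ : 0 ≤ τ) (hε : 0 < ε) :
    |Real.log (τ * Real.exp φ + ε) - Real.log (τ + ε)| ≤ |φ| := by
  have h1 : 0 < τ * Real.exp φ + ε := by positivity
  have h2 : 0 < τ + ε := by positivity
  rw [abs_le]
  constructor
  · rw [neg_le_sub_iff_le_add, ← Real.log_exp |φ|, ← Real.log_mul h1.ne' (Real.exp_pos _).ne']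
    refine Real.log_le_log h2 ?_
    have h3 : 1 ≤ Real.exp φ * Real.exp |φ| := by
      rw [← Real.exp_add]
      exact Real.one_le_exp (by linarith [neg_abs_le φ])
    have h4 : 1 ≤ Real.exp |φ| := Real.one_le_exp (abs_nonneg _)
    nlinarith
  · rw [sub_le_iff_le_add, ← Real.log_exp |φ|, ← Real.log_mul (Real.exp_pos _).ne' h2.ne']
    refine Real.log_le_log h1 ?_
    have h3 : Real.exp φ ≤ Real.exp |φ| := Real.exp_le_exp.2 (le_abs_self _)
    have h4 : 1 ≤ Real.exp |φ| := Real.one_le_exp (abs_nonneg _)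
    nlinarith

/-- If `h` distorts distances on the circle by the factor `exp Φ`, then the energy with kernel `Φ`
of a charge of total mass zero is bounded by its logarithmic energy on the circle. -/
theorem integral_distortion_le {h : ℝ → ℂ} (hh : Continuous h) {Φ : ℝ × ℝ → ℝ}
    (hΦ : Continuous Φ)
    (hdist : ∀ t s, ‖h t - h s‖ ^ 2 = ‖unitExp t - unitExp s‖ ^ 2 * Real.exp (2 * Φ (t, s)))
    {x : ℝ → ℝ} (hx : Continuous x) (hx0 : ∫ t, x t ∂arcMeasure = 0)
    (hs : Summable fun k : ℕ => ‖moment (fun t => x t) k‖ ^ 2 / k) :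
    ∫ y, Φ y * (x y.1 * x y.2) ∂(arcMeasure.prod arcMeasure) ≤
      ∑' k : ℕ, ‖moment (fun t => x t) k‖ ^ 2 / k := by
  set ε : ℝ → ℝ := fun ρ => (1 - ρ) ^ 2 / ρ with hεdef
  set τ : ℝ × ℝ → ℝ := fun y => ‖unitExp y.1 - unitExp y.2‖ ^ 2 with hτ
  have hτc : Continuous τ := by fun_prop
  -- Each logarithm may blow up at the diagonal as `ρ → 1`, but the difference stays bounded by
  -- `|2Φ|` and tends to `2Φ` almost everywhere.
  set D : ℝ → ℝ × ℝ → ℝ := fun ρ y =>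
    Real.log (τ y * Real.exp (2 * Φ y) + ε ρ) - Real.log (τ y + ε ρ) with hD
  have hτ0 : ∀ y, 0 ≤ τ y := fun y => by positivity
  -- The bound `1/2 < ρ` ensures `ε ρ ≤ 1`, which the positivity of the energy requires.
  have hρ : ∀ᶠ ρ in 𝓝[<] (1 : ℝ), ρ ∈ Ioo (1 / 2 : ℝ) 1 :=
    Ioo_mem_nhdsLT (by norm_num)
  have hε0 : ∀ ρ ∈ Ioo (1 / 2 : ℝ) 1, 0 < ε ρ := fun ρ hρ =>
    div_pos (pow_pos (by linarith [hρ.2]) 2) (by linarith [hρ.1])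
  have hc1 : ∀ ρ ∈ Ioo (1 / 2 : ℝ) 1,
      Continuous fun y => Real.log (τ y * Real.exp (2 * Φ y) + ε ρ) := fun ρ hρ =>
    Continuous.log (by fun_prop) fun y => by have := hε0 ρ hρ; have := hτ0 y; positivity
  have hc2 : ∀ ρ ∈ Ioo (1 / 2 : ℝ) 1, Continuous fun y => Real.log (τ y + ε ρ) := fun ρ hρ =>
    Continuous.log (by fun_prop) fun y => by have := hε0 ρ hρ; have := hτ0 y; positivity
  have hbound : ∀ᶠ ρ in 𝓝[<] (1 : ℝ), ∫ y, D ρ y * (x y.1 * x y.2)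
      ∂(arcMeasure.prod arcMeasure) ≤ 2 * ∑' k : ℕ, ‖moment (fun t => x t) k‖ ^ 2 / k := by
    filter_upwards [hρ] with ρ hρ
    have hρ0 : 0 < ρ := by linarith [hρ.1]
    have hε1 : ε ρ ≤ 1 := by
      rw [hεdef]
      simp only
      rw [div_le_one hρ0]
      nlinarith [hρ.1, hρ.2]
    have hE := log_energy_nonneg hh hx hx0 (hε0 ρ hρ) hε1
    have hdist' : ∀ y : ℝ × ℝ, ‖h y.1 - h y.2‖ ^ 2 = τ y * Real.exp (2 * Φ y) := fun y =>
      hdist y.1 y.2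
    simp_rw [hdist'] at hE
    have hC := hasSum_circle_energy hx hx0 hρ0 hρ.2
    have hle := hC.tsum_eq ▸ (hC.summable.tsum_le_tsum (fun k => by
      have : ρ ^ k ≤ 1 := pow_le_one₀ hρ0.le hρ.2.le
      exact mul_le_of_le_one_left (by positivity) this) (hs.mul_left 2))
    rw [tsum_mul_left] at hle
    simp only [hD, sub_mul]
    have c1 := hc1 ρ hρ
    have c2 := hc2 ρ hρ
    rw [integral_sub (Continuous.integrable_arcMeasure_prod (by fun_prop))
      (Continuous.integrable_arcMeasure_prod (by fun_prop))]
    linarith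
  have hlim : Tendsto (fun ρ => ∫ y, D ρ y * (x y.1 * x y.2) ∂(arcMeasure.prod arcMeasure))
      (𝓝[<] (1 : ℝ)) (𝓝 (∫ y, 2 * Φ y * (x y.1 * x y.2) ∂(arcMeasure.prod arcMeasure))) := by
    refine tendsto_integral_filter_of_dominated_convergence
      (fun y => |2 * Φ y| * ‖x y.1 * x y.2‖) ?_ ?_ ?_ ?_
    · filter_upwards [hρ] with ρ hρ
      have c1 := hc1 ρ hρ
      have c2 := hc2 ρ hρ
      exact Continuous.aestronglyMeasurable (by fun_prop)
    · filter_upwards [hρ] with ρ hρ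
      refine Eventually.of_forall fun y => ?_
      rw [norm_mul]
      gcongr
      exact abs_log_div_le (hτ0 y) (hε0 ρ hρ)
    · exact Continuous.integrable_arcMeasure_prod (by fun_prop)
    · filter_upwards [ae_unitExp_ne] with y hy
      have hτp : 0 < τ y := by
        have : 0 < ‖unitExp y.1 - unitExp y.2‖ := norm_pos_iff.2 (sub_ne_zero.2 hy)
        simp only [hτ]; positivity
      have hεl : Tendsto ε (𝓝[<] (1 : ℝ)) (𝓝 0) := by
        have : ContinuousAt ε 1 := by
          simp only [hεdef]
          exact ContinuousAt.div (by fun_prop) (by fun_prop) one_ne_zero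
        have h2 := this.tendsto.mono_left (nhdsWithin_le_nhds (s := Iio 1))
        simpa [hεdef] using h2
      have hp : 0 < τ y * Real.exp (2 * Φ y) := by positivity
      have h1 : Tendsto (fun ρ => D ρ y) (𝓝[<] (1 : ℝ))
          (𝓝 (Real.log (τ y * Real.exp (2 * Φ y) + 0) - Real.log (τ y + 0))) :=
        ((hεl.const_add _).log (by simpa using hp.ne')).sub
          ((hεl.const_add _).log (by simpa using hτp.ne'))
      rw [add_zero, add_zero, Real.log_mul hτp.ne' (Real.exp_pos _).ne', Real.log_exp,
        add_sub_cancel_left] at h1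
      exact h1.mul_const _
  have := le_of_tendsto hlim hbound
  simp_rw [mul_assoc] at this
  rw [integral_const_mul] at this
  linarith

/-! ### Cauchy's formula and the charges representing derivatives -/

theorem norm_mul_unitExp {r : ℝ} (hr : 0 < r) (t : ℝ) : ‖(r : ℂ) * unitExp t‖ = r := by
  simp [abs_of_pos hr]

theorem mul_unitExp_mem {r : ℝ} (hr : 0 < r) (hr1 : r < 1) (t : ℝ) :
    (r : ℂ) * unitExp t ∈ unitDisk := by
  rw [mem_unitDisk, norm_mul_unitExp hr]
  exact hr1

theorem closedBall_subset_unitDisk {r : ℝ} (hr1 : r < 1) :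
    Metric.closedBall (0 : ℂ) r ⊆ unitDisk := Metric.closedBall_subset_ball hr1

theorem circleIntegral_eq_integral_arcMeasure (r : ℝ) (g : ℂ → ℂ) :
    (∮ w in C(0, r), g w) =
      ∫ t, (r * unitExp t * Complex.I) * g (r * unitExp t) ∂arcMeasure := by
  rw [circleIntegral, intervalIntegral.integral_of_le (by positivity)]
  simp only [deriv_circleMap, circleMap_zero, smul_eq_mul, unitExp]

/-- Cauchy's formula for derivatives at points other than the center. -/
theorem circleIntegral_inv_pow_mul {g : ℂ → ℂ} {U : Set ℂ} (hU : IsOpen U)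
    (hg : DifferentiableOn ℂ g U) {r : ℝ} (hrU : Metric.closedBall (0 : ℂ) r ⊆ U) {z : ℂ}
    (hz : ‖z‖ < r) (p : ℕ) :
    (p.factorial : ℂ) * (∮ w in C(0, r), ((w - z) ^ (p + 1))⁻¹ * g w) =
      2 * Real.pi * Complex.I * iteratedDeriv p g z := by
  have hr : 0 < r := (norm_nonneg z).trans_lt hz
  induction p generalizing g with
  | zero =>
    have := (hg.mono hrU).circleIntegral_sub_inv_smul (w := z) (by simpa using hz)
    simpa using this
  | succ p ih =>
    have hne : ∀ w ∈ Metric.sphere (0 : ℂ) r, w - z ≠ 0 := by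
      intro w hw h
      rw [sub_eq_zero.1 h] at hw
      simp at hw
      linarith
    have hgd := hg.deriv hU
    rw [iteratedDeriv_succ', ← ih hgd]
    have hsph : Metric.sphere (0 : ℂ) r ⊆ U := Metric.sphere_subset_closedBall.trans hrU
    have hc1 : ContinuousOn (fun w => ((w - z) ^ (p + 1))⁻¹ * deriv g w) (Metric.sphere 0 r) :=
      ContinuousOn.mul (ContinuousOn.inv₀ (by fun_prop) fun w hw => pow_ne_zero _ (hne w hw))
        (hgd.continuousOn.mono hsph)
    have hc2 : ContinuousOn (fun w => ((w - z) ^ (p + 2))⁻¹ * g w) (Metric.sphere 0 r) :=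
      ContinuousOn.mul (ContinuousOn.inv₀ (by fun_prop) fun w hw => pow_ne_zero _ (hne w hw))
        (hg.continuousOn.mono hsph)
    -- Integration by parts: a derivative has zero integral over the closed circle, which trades one
    -- power of `w - z` for one derivative of `g`.
    have hparts := circleIntegral.integral_eq_zero_of_hasDerivWithinAt (c := 0) (R := r)
      (f := fun w => ((w - z) ^ (p + 1))⁻¹ * g w)
      (f' := fun w => ((w - z) ^ (p + 1))⁻¹ * deriv g w -
        ((p : ℂ) + 1) * (((w - z) ^ (p + 2))⁻¹ * g w)) hr.le (by
      intro w hw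
      have h1 : HasDerivAt (fun w => (w - z) ^ (p + 1)) (((p : ℂ) + 1) * (w - z) ^ p) w := by
        simpa using ((hasDerivAt_id w).sub_const z).fun_pow (p + 1)
      have h2 := (h1.fun_inv (pow_ne_zero _ (hne w hw))).fun_mul
        (hg.differentiableAt (hU.mem_nhds (hsph hw))).hasDerivAt
      refine (h2.congr_deriv ?_).hasDerivWithinAt
      have := hne w hw
      field_simp
      ring)
    rw [circleIntegral.integral_sub (hc1.circleIntegrable hr.le)
      ((continuousOn_const.fun_mul hc2).circleIntegrable hr.le),
      circleIntegral.integral_const_mul] at hparts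
    rw [sub_eq_zero.1 hparts, Nat.factorial_succ]
    push_cast
    ring

/-- The charge on the circle of radius `r` that represents the `p`-th derivative at `z`. -/
noncomputable def cauchyCharge (p : ℕ) (r : ℝ) (z : ℂ) (t : ℝ) : ℂ :=
  (2 * Real.pi : ℂ)⁻¹ * p.factorial * (r * unitExp t) * ((r * unitExp t - z) ^ (p + 1))⁻¹

theorem mul_unitExp_sub_ne_zero {r : ℝ} {z : ℂ} (hz : ‖z‖ < r) (t : ℝ) :
    (r : ℂ) * unitExp t - z ≠ 0 := by
  intro h
  have := norm_mul_unitExp ((norm_nonneg z).trans_lt hz) t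
  rw [sub_eq_zero.1 h] at this
  linarith

theorem continuous_cauchyCharge (p : ℕ) {r : ℝ} {z : ℂ} (hz : ‖z‖ < r) :
    Continuous (cauchyCharge p r z) := by
  unfold cauchyCharge
  refine Continuous.mul (by fun_prop) (Continuous.inv₀ (by fun_prop) fun t => ?_)
  exact pow_ne_zero _ (mul_unitExp_sub_ne_zero hz t)

theorem integral_mul_cauchyCharge {g : ℂ → ℂ} (hg : DifferentiableOn ℂ g unitDisk) {r : ℝ}
    (hr1 : r < 1) {z : ℂ} (hz : ‖z‖ < r) (p : ℕ) :
    ∫ t, g (r * unitExp t) * cauchyCharge p r z t ∂arcMeasure = iteratedDeriv p g z := by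
  have h := circleIntegral_inv_pow_mul isOpen_unitDisk hg (closedBall_subset_unitDisk hr1) hz p
  rw [circleIntegral_eq_integral_arcMeasure] at h
  have hpi : (2 * Real.pi * Complex.I : ℂ) ≠ 0 := Complex.two_pi_I_ne_zero
  have h2pi : (2 * Real.pi : ℂ) ≠ 0 := fun h => hpi (by rw [h, zero_mul])
  have hpt : ∀ t, g (r * unitExp t) * cauchyCharge p r z t =
      ((2 * Real.pi * Complex.I : ℂ)⁻¹ * p.factorial) * ((r * unitExp t * Complex.I) *
        (((r * unitExp t - z) ^ (p + 1))⁻¹ * g (r * unitExp t))) := by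
    intro t
    have hI := Complex.I_ne_zero
    rw [cauchyCharge, mul_inv]
    field_simp
  simp_rw [hpt]
  rw [integral_const_mul, mul_assoc, h, inv_mul_cancel_left₀ hpi]

/-- Holomorphic functions annihilate the conjugate of `X` on the circle of radius `r`: the
charge `X` has only negative frequencies. -/
structure IsHardyCharge (r : ℝ) (X : ℝ → ℂ) : Prop where
  continuous : Continuous X
  annihilates : ∀ g : ℂ → ℂ, DifferentiableOn ℂ g unitDisk →
    ∫ t, g (r * unitExp t) * (starRingEnd ℂ) (X t) ∂arcMeasure = 0

theorem continuous_comp_mul_unitExp {g : ℂ → ℂ} (hg : ContinuousOn g unitDisk) {r : ℝ}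
    (hr : 0 < r) (hr1 : r < 1) : Continuous fun t => g (r * unitExp t) :=
  hg.comp_continuous (by fun_prop) fun t => mul_unitExp_mem hr hr1 t

theorem IsHardyCharge.add {r : ℝ} (hr : 0 < r) (hr1 : r < 1) {X Y : ℝ → ℂ}
    (hX : IsHardyCharge r X) (hY : IsHardyCharge r Y) :
    IsHardyCharge r (fun t => X t + Y t) := by
  refine ⟨hX.continuous.add hY.continuous, fun g hg => ?_⟩
  have hgc := continuous_comp_mul_unitExp hg.continuousOn hr hr1
  have h1 : Continuous fun t => (starRingEnd ℂ) (X t) := Complex.continuous_conj.comp hX.continuous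
  have h2 : Continuous fun t => (starRingEnd ℂ) (Y t) := Complex.continuous_conj.comp hY.continuous
  simp_rw [map_add, mul_add]
  rw [integral_add (hgc.fun_mul h1).integrable_arcMeasure (hgc.fun_mul h2).integrable_arcMeasure,
    hX.annihilates g hg, hY.annihilates g hg, add_zero]

theorem IsHardyCharge.const_mul {r : ℝ} {X : ℝ → ℂ} (hX : IsHardyCharge r X) (c : ℂ) :
    IsHardyCharge r (fun t => c * X t) := by
  refine ⟨hX.continuous.const_mul c, fun g hg => ?_⟩
  simp_rw [map_mul, mul_left_comm _ ((starRingEnd ℂ) c)]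
  rw [integral_const_mul, hX.annihilates g hg, mul_zero]

/-- On `|w| = r` the conjugate of `w` is `r^2 / w`, so the conjugate charge is a constant times `w^p
/ (r^2 - conj z * w)^(p+1)`. Since `dt = dw / (i w)`, the condition `1 ≤ p` leaves no pole at the
origin, and Cauchy's theorem applies. -/
theorem isHardyCharge_cauchyCharge {p : ℕ} (hp : 1 ≤ p) {r : ℝ} (hr1 : r < 1) {z : ℂ}
    (hz : ‖z‖ < r) : IsHardyCharge r (cauchyCharge p r z) := by
  refine ⟨continuous_cauchyCharge p hz, fun g hg => ?_⟩
  have hr : 0 < r := (norm_nonneg z).trans_lt hz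
  have hr0 : (r : ℂ) ≠ 0 := by exact_mod_cast hr.ne'
  obtain ⟨n, rfl⟩ : ∃ n, p = n + 1 := ⟨p - 1, by omega⟩
  set zc := (starRingEnd ℂ) z with hzc
  have hne : ∀ w ∈ Metric.closedBall (0 : ℂ) r, (r : ℂ) ^ 2 - zc * w ≠ 0 := by
    intro w hw h
    have h1 : ‖zc * w‖ = r ^ 2 := by
      rw [← sub_eq_zero.1 h]; simp
    rw [norm_mul, hzc, RCLike.norm_conj] at h1
    have h2 : ‖w‖ ≤ r := by simpa using hw
    nlinarith [norm_nonneg z, norm_nonneg w]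
  set G : ℂ → ℂ := fun w => g w * w ^ n * (((r : ℂ) ^ 2 - zc * w) ^ (n + 2))⁻¹ with hG
  have hGd : DifferentiableOn ℂ G (Metric.closedBall 0 r) := by
    refine ((hg.mono (closedBall_subset_unitDisk hr1)).mul (by fun_prop)).mul
      (DifferentiableOn.inv (by fun_prop) fun w hw => pow_ne_zero _ (hne w hw))
  have h0 : (∮ w in C(0, r), G w) = 0 :=
    (hGd.mono Metric.closure_ball_subset_closedBall).diffContOnCl.circleIntegral_eq_zero hr.le
  rw [circleIntegral_eq_integral_arcMeasure] at h0
  have hpt : ∀ t, g (r * unitExp t) * (starRingEnd ℂ) (cauchyCharge (n + 1) r z t) =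
      ((2 * Real.pi : ℂ)⁻¹ * (n + 1).factorial * r ^ 2 * Complex.I⁻¹) *
        ((r * unitExp t * Complex.I) * G (r * unitExp t)) := by
    intro t
    have hu := unitExp_ne_zero t
    have hI := Complex.I_ne_zero
    have hw : (r : ℂ) ^ 2 - zc * (r * unitExp t) ≠ 0 := hne _ (by simp [abs_of_pos hr])
    have e : (r : ℂ) * (unitExp t)⁻¹ - zc = ((r : ℂ) ^ 2 - zc * (r * unitExp t)) /
        (r * unitExp t) := by
      field_simp
    simp only [cauchyCharge, hG, map_mul, map_inv₀, map_pow, map_sub, map_natCast,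
      Complex.conj_ofReal, conj_unitExp, map_ofNat, ← hzc]
    rw [e, div_pow, inv_div]
    field_simp
    ring
  simp_rw [hpt]
  rw [integral_const_mul, h0, mul_zero]

/-- The moment is the `p`-th derivative of `(w / r)^k` at `z`. For `k < p` the falling factorial
vanishes, so the truncated exponent is harmless. -/
theorem moment_cauchyCharge {r : ℝ} (hr1 : r < 1) {z : ℂ} (hz : ‖z‖ < r) (p k : ℕ) :
    moment (cauchyCharge p r z) k = (r : ℂ)⁻¹ ^ k * (k.descFactorial p * z ^ (k - p)) := by
  have hr : 0 < r := (norm_nonneg z).trans_lt hz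
  have hr0 : (r : ℂ) ≠ 0 := by exact_mod_cast hr.ne'
  have := integral_mul_cauchyCharge (g := fun w => (r : ℂ)⁻¹ ^ k * w ^ k) (by fun_prop) hr1 hz p
  rw [iteratedDeriv_const_mul_field, iteratedDeriv_pow] at this
  rw [← this, moment]
  congr 1
  ext t
  rw [mul_pow, ← mul_assoc ((r : ℂ)⁻¹ ^ k), ← mul_pow, inv_mul_cancel₀ hr0, one_pow, one_mul]

/-- With `p = n + 1` and `k = m + p`, take the factor `k` out of one copy of the falling factorial
and shift the remaining `n` factors up, past the other copy; together they form a rising factorial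
of length `2p - 1`. -/
theorem descFactorial_sq_le (n m : ℕ) :
    ((m + (n + 1)).descFactorial (n + 1)) ^ 2 ≤
      (m + (n + 1)) * ((2 * n + 1).factorial * (m + (2 * n + 1)).choose (2 * n + 1)) := by
  rw [Nat.add_descFactorial_eq_ascFactorial, ← Nat.ascFactorial_eq_factorial_mul_choose,
    show 2 * n + 1 = (n + 1) + n by ring,
    ← Nat.ascFactorial_mul_ascFactorial (m + 1) (n + 1) n, sq]
  have h1 : (m + 1).ascFactorial (n + 1) = (m + (n + 1)) * (m + 1).ascFactorial n := by
    rw [Nat.ascFactorial_succ]; ring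
  have h2 : (m + 1).ascFactorial n ≤ (m + 1 + (n + 1)).ascFactorial n :=
    Nat.ascFactorial_le n (by omega)
  calc (m + 1).ascFactorial (n + 1) * (m + 1).ascFactorial (n + 1)
      = (m + (n + 1)) * ((m + 1).ascFactorial (n + 1) * (m + 1).ascFactorial n) := by
        nth_rewrite 2 [h1]; ring
    _ ≤ _ := by gcongr

/-- Termwise comparison with `∑ (m+2p-1).choose (2p-1) * N^m = (1 - N)^(-2p)`, where `N = (|z| /
r)^2`. -/
theorem energy_cauchyCharge {p : ℕ} (hp : 1 ≤ p) {r : ℝ} (hr1 : r < 1) {z : ℂ} (hz : ‖z‖ < r) :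
    Summable (fun k : ℕ => ‖moment (cauchyCharge p r z) k‖ ^ 2 / k) ∧
      ∑' k : ℕ, ‖moment (cauchyCharge p r z) k‖ ^ 2 / k ≤
        (2 * p - 1).factorial * (r / (r ^ 2 - ‖z‖ ^ 2)) ^ (2 * p) := by
  have hr : 0 < r := (norm_nonneg z).trans_lt hz
  obtain ⟨n, rfl⟩ : ∃ n, p = n + 1 := ⟨p - 1, by omega⟩
  set N : ℝ := (‖z‖ / r) ^ 2 with hN
  have hN0 : 0 ≤ N := by positivity
  have hN1 : N < 1 := by
    rw [hN]
    exact pow_lt_one₀ (by positivity) ((div_lt_one hr).2 hz) two_ne_zero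
  set a : ℕ → ℝ := fun k => ‖moment (cauchyCharge (n + 1) r z) k‖ ^ 2 / k with ha
  have hinj : Function.Injective fun m : ℕ => m + (n + 1) := add_left_injective _
  have hzero : ∀ k ∉ range (fun m : ℕ => m + (n + 1)), a k = 0 := by
    intro k hk
    have hk' : k < n + 1 := by
      by_contra! h
      exact hk ⟨k - (n + 1), by simp; omega⟩
    simp only [ha, moment_cauchyCharge hr1 hz, Nat.descFactorial_of_lt hk']
    simp
  have hgeo := (hasSum_choose_mul_geometric_of_norm_lt_one (2 * n + 1) (r := N)
    (by rwa [Real.norm_of_nonneg hN0])).mul_left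
      ((2 * n + 1).factorial * (r⁻¹) ^ (2 * (n + 1)))
  have hle : ∀ m : ℕ, a (m + (n + 1)) ≤ (2 * n + 1).factorial * (r⁻¹) ^ (2 * (n + 1)) *
      (((m + (2 * n + 1)).choose (2 * n + 1) : ℝ) * N ^ m) := by
    intro m
    have hd : (((m + (n + 1)).descFactorial (n + 1) : ℝ)) ^ 2 ≤ ((m + (n + 1) : ℕ) : ℝ) *
        ((2 * n + 1).factorial * ((m + (2 * n + 1)).choose (2 * n + 1) : ℝ)) := by
      exact_mod_cast descFactorial_sq_le n m
    simp only [ha, moment_cauchyCharge hr1 hz, norm_mul, norm_pow, norm_inv, Complex.norm_real,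
      Complex.norm_natCast, Nat.add_sub_cancel, Real.norm_of_nonneg hr.le]
    rw [div_le_iff₀ (by positivity)]
    calc (r⁻¹ ^ (m + (n + 1)) * (((m + (n + 1)).descFactorial (n + 1) : ℝ) * ‖z‖ ^ m)) ^ 2
        = ((m + (n + 1)).descFactorial (n + 1) : ℝ) ^ 2 * (r⁻¹ ^ (2 * (n + 1)) * N ^ m) := by
          rw [hN]; ring
      _ ≤ _ := mul_le_mul_of_nonneg_right hd (by positivity)
      _ = _ := by ring
  have hsum' : Summable fun m : ℕ => a (m + (n + 1)) :=
    Summable.of_nonneg_of_le (fun m => by positivity) hle hgeo.summable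
  have hsum : Summable a := (hinj.summable_iff hzero).1 hsum'
  refine ⟨hsum, ?_⟩
  have hts : ∑' k, a k = ∑' m : ℕ, a (m + (n + 1)) :=
    (hinj.tsum_eq fun k hk => by
      by_contra h
      exact hk (hzero k h)).symm
  rw [hts]
  refine (hsum'.tsum_le_tsum hle hgeo.summable).trans (le_of_eq ?_)
  rw [hgeo.tsum_eq, show 2 * (n + 1) - 1 = 2 * n + 1 by omega, mul_assoc,
    show 2 * n + 1 + 1 = 2 * (n + 1) by ring, one_div, ← inv_pow, ← mul_pow]
  congr 2
  have h1 : r ^ 2 - ‖z‖ ^ 2 ≠ 0 := by nlinarith [norm_nonneg z]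
  have h2 : 1 - N ≠ 0 := by linarith
  rw [← mul_inv, eq_comm, div_eq_iff h1, eq_comm, inv_mul_eq_iff_eq_mul₀ (mul_ne_zero hr.ne' h2),
    hN]
  field_simp

/-! ### Holomorphic dependence on a parameter -/

/-- An integral over a compact set that depends holomorphically on a parameter is holomorphic. -/
theorem differentiableOn_integral_of_continuousOn {T : Type*} [TopologicalSpace T]
    [SecondCountableTopology T] [MeasurableSpace T] [OpensMeasurableSpace T] {μ : Measure T}
    [IsFiniteMeasure μ] {K : Set T} (hK : IsCompact K) (hμ : ∀ᵐ t ∂μ, t ∈ K) {U : Set ℂ}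
    (hU : IsOpen U) {Φ : ℂ → T → ℂ} (hc : ContinuousOn (fun y : ℂ × T => Φ y.1 y.2) (U ×ˢ univ))
    (hd : ∀ t, DifferentiableOn ℂ (fun z => Φ z t) U) :
    DifferentiableOn ℂ (fun z => ∫ t, Φ z t ∂μ) U := by
  intro z₀ hz₀
  obtain ⟨ε, hε, hball⟩ := Metric.nhds_basis_closedBall.mem_iff.1 (hU.mem_nhds hz₀)
  obtain ⟨C, hC⟩ := ((isCompact_closedBall z₀ ε).prod hK).exists_bound_of_continuousOn
    (hc.mono (prod_mono hball (subset_univ _)))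
  set δ := ε / 2 with hδ
  have hδ0 : 0 < δ := by positivity
  have hcz : ∀ z ∈ U, Continuous (Φ z) := fun z hz =>
    hc.comp_continuous (f := fun t => (z, t)) (by fun_prop) fun t => ⟨hz, trivial⟩
  have hb : ∀ᵐ t ∂μ, ∀ z ∈ Metric.closedBall z₀ ε, ‖Φ z t‖ ≤ C := by
    filter_upwards [hμ] with t ht z hz using hC (z, t) ⟨hz, ht⟩
  -- The derivative in the parameter is a pointwise limit of difference quotients along a sequence,
  -- each continuous in `t`.
  have hmeas : AEStronglyMeasurable (fun t => deriv (fun z => Φ z t) z₀) μ := by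
    set zn : ℕ → ℂ := fun n => z₀ + (δ / ((n : ℝ) + 1) : ℝ) with hzn
    have hpos : ∀ n : ℕ, 0 < δ / ((n : ℝ) + 1) := fun n => by positivity
    have hznU : ∀ n, zn n ∈ U := fun n => hball (by
      have h1 : δ / ((n : ℝ) + 1) ≤ δ := div_le_self hδ0.le (by linarith [n.cast_nonneg (α := ℝ)])
      rw [mem_closedBall_iff_norm]
      simp only [hzn, add_sub_cancel_left, Complex.norm_real]
      rw [Real.norm_of_nonneg (hpos n).le]
      linarith)
    have hlim : Tendsto zn atTop (𝓝[≠] z₀) := by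
      refine tendsto_nhdsWithin_iff.2 ⟨?_, Eventually.of_forall fun n => ?_⟩
      · have h1 : Tendsto (fun n : ℕ => δ / ((n : ℝ) + 1)) atTop (𝓝 0) :=
          tendsto_const_div_atTop_nhds_zero_nat δ |>.comp (tendsto_add_atTop_nat 1) |>.congr
            fun n => by simp
        have h2 := (Complex.continuous_ofReal.tendsto 0).comp h1
        simpa [hzn] using h2.const_add z₀
      · simp only [hzn, mem_compl_iff, mem_singleton_iff, add_eq_left]
        exact_mod_cast (hpos n).ne'
    refine aestronglyMeasurable_of_tendsto_ae atTop
      (f := fun n t => slope (fun z => Φ z t) z₀ (zn n)) (fun n => ?_)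
      (Eventually.of_forall fun t => ?_)
    · simp only [slope_def_field]
      exact (((hcz _ (hznU n)).sub (hcz _ hz₀)).div_const _).aestronglyMeasurable
    · exact (hasDerivAt_iff_tendsto_slope.1
        ((hd t).differentiableAt (hU.mem_nhds hz₀)).hasDerivAt).comp hlim
  have main := hasDerivAt_integral_of_dominated_loc_of_deriv_le (μ := μ) (F := Φ)
    (F' := fun z t => deriv (fun z => Φ z t) z) (bound := fun _ => C / δ)
    (Metric.ball_mem_nhds z₀ hδ0)
    (by
      filter_upwards [hU.mem_nhds hz₀] with z hz using (hcz z hz).aestronglyMeasurable)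
    (by
      refine (integrable_const C).mono' (hcz z₀ hz₀).aestronglyMeasurable ?_
      filter_upwards [hb] with t ht using ht z₀ (Metric.mem_closedBall_self hε.le))
    hmeas
    -- Cauchy's estimate on circles of radius `δ = ε / 2`, which stay inside the ball where `Φ` is
    -- bounded by `C`.
    (by
      filter_upwards [hb] with t ht z hz
      have hsub : Metric.closedBall z δ ⊆ Metric.closedBall z₀ ε := by
        refine Metric.closedBall_subset_closedBall' ?_
        have : dist z z₀ < δ := hz
        linarith
      refine Complex.norm_deriv_le_of_forall_mem_sphere_norm_le hδ0 ?_ fun w hw =>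
        ht w (hsub (Metric.sphere_subset_closedBall hw))
      exact ((hd t).mono (Metric.closure_ball_subset_closedBall.trans
        (hsub.trans hball))).diffContOnCl)
    (integrable_const _)
    (Eventually.of_forall fun t z hz => ((hd t).differentiableAt (hU.mem_nhds (hball
      (Metric.closedBall_subset_closedBall (by linarith : δ ≤ ε)
        (Metric.ball_subset_closedBall hz))))).hasDerivAt)
  exact main.2.differentiableAt.differentiableWithinAt

theorem ae_mem_Icc_arcMeasure : ∀ᵐ t ∂arcMeasure, t ∈ Icc 0 (2 * Real.pi) :=
  (ae_restrict_iff' measurableSet_Ioc).2 (Eventually.of_forall fun _ ht => Ioc_subset_Icc_self ht)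

theorem continuousOn_cauchyCharge (p : ℕ) (r : ℝ) :
    ContinuousOn (fun y : ℂ × ℝ => cauchyCharge p r y.1 y.2) (Metric.ball 0 r ×ˢ univ) := by
  unfold cauchyCharge
  refine ContinuousOn.mul (by fun_prop) (ContinuousOn.inv₀ (by fun_prop) fun y hy => ?_)
  exact pow_ne_zero _ (mul_unitExp_sub_ne_zero (by simpa using hy.1) _)

theorem differentiableOn_cauchyCharge (p : ℕ) (r : ℝ) (t : ℝ) :
    DifferentiableOn ℂ (fun z => cauchyCharge p r z t) (Metric.ball 0 r) := by
  unfold cauchyCharge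
  refine DifferentiableOn.mul (by fun_prop) (DifferentiableOn.inv (by fun_prop) fun z hz => ?_)
  exact pow_ne_zero _ (mul_unitExp_sub_ne_zero (by simpa using hz) _)

/-! ### Pairings on the torus -/

section Bidisk

variable {F : ℂ × ℂ → ℂ}

theorem differentiableOn_fst_of_bidisk (hF : DifferentiableOn ℂ F (unitDisk ×ˢ unitDisk)) {w : ℂ}
    (hw : w ∈ unitDisk) : DifferentiableOn ℂ (fun z => F (z, w)) unitDisk :=
  hF.comp (by fun_prop) fun _ hz => ⟨hz, hw⟩

theorem differentiableOn_snd_of_bidisk (hF : DifferentiableOn ℂ F (unitDisk ×ˢ unitDisk)) {z : ℂ}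
    (hz : z ∈ unitDisk) : DifferentiableOn ℂ (fun w => F (z, w)) unitDisk :=
  hF.comp (by fun_prop) fun _ hw => ⟨hz, hw⟩

theorem continuous_torus (hF : DifferentiableOn ℂ F (unitDisk ×ˢ unitDisk)) {r : ℝ} (hr : 0 < r)
    (hr1 : r < 1) : Continuous fun y : ℝ × ℝ => F (r * unitExp y.1, r * unitExp y.2) :=
  hF.continuousOn.comp_continuous (by fun_prop) fun y =>
    ⟨mul_unitExp_mem hr hr1 y.1, mul_unitExp_mem hr hr1 y.2⟩

theorem continuous_torus_mul (hF : DifferentiableOn ℂ F (unitDisk ×ˢ unitDisk)) {r : ℝ}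
    (hr : 0 < r) (hr1 : r < 1) {X Y : ℝ → ℂ} (hX : Continuous X) (hY : Continuous Y) :
    Continuous fun y : ℝ × ℝ => F (r * unitExp y.1, r * unitExp y.2) * (X y.1 * Y y.2) :=
  (continuous_torus hF hr hr1).mul ((hX.comp continuous_fst).mul (hY.comp continuous_snd))

/-- The pairing of a function on the torus of radius `r` with two charges. -/
noncomputable def torusPairing (F : ℂ × ℂ → ℂ) (r : ℝ) (X Y : ℝ → ℂ) : ℂ :=
  ∫ y, F (r * unitExp y.1, r * unitExp y.2) * (X y.1 * Y y.2) ∂(arcMeasure.prod arcMeasure)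

theorem torusPairing_eq_integral_integral (hF : DifferentiableOn ℂ F (unitDisk ×ˢ unitDisk))
    {r : ℝ} (hr : 0 < r) (hr1 : r < 1) {X Y : ℝ → ℂ} (hX : Continuous X) (hY : Continuous Y) :
    torusPairing F r X Y =
      ∫ t, (∫ s, F (r * unitExp t, r * unitExp s) * Y s ∂arcMeasure) * X t ∂arcMeasure := by
  rw [torusPairing, integral_prod _
    (continuous_torus_mul hF hr hr1 hX hY).integrable_arcMeasure_prod]
  congr 1
  ext t
  rw [← integral_mul_const]
  congr 1
  ext s
  ring

theorem torusPairing_eq_integral_integral_symm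
    (hF : DifferentiableOn ℂ F (unitDisk ×ˢ unitDisk))
    {r : ℝ} (hr : 0 < r) (hr1 : r < 1) {X Y : ℝ → ℂ} (hX : Continuous X) (hY : Continuous Y) :
    torusPairing F r X Y =
      ∫ s, (∫ t, F (r * unitExp t, r * unitExp s) * X t ∂arcMeasure) * Y s ∂arcMeasure := by
  rw [torusPairing, integral_prod_symm _
    (continuous_torus_mul hF hr hr1 hX hY).integrable_arcMeasure_prod]
  congr 1
  ext t
  rw [← integral_mul_const]
  congr 1
  ext s
  ring

/-- Cauchy's formula in each variable; the outer application needs the inner integral to be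
holomorphic in `ζ`. -/
theorem mixedPartial_eq_torusPairing (hF : DifferentiableOn ℂ F (unitDisk ×ˢ unitDisk)) {r : ℝ}
    (hr1 : r < 1) {z w : ℂ} (hz : ‖z‖ < r) (hw : ‖w‖ < r) (p q : ℕ) :
    mixedPartial F p q z w =
      torusPairing F r (cauchyCharge p r z) (cauchyCharge q r w) := by
  have hr : 0 < r := (norm_nonneg z).trans_lt hz
  have hin : ∀ ζ ∈ unitDisk, iteratedDeriv q (fun ω => F (ζ, ω)) w =
      ∫ s, F (ζ, r * unitExp s) * cauchyCharge q r w s ∂arcMeasure := fun ζ hζ =>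
    (integral_mul_cauchyCharge (differentiableOn_snd_of_bidisk hF hζ) hr1 hw q).symm
  have hKc := continuous_cauchyCharge q hw
  have hdiff : DifferentiableOn ℂ
      (fun ζ => ∫ s, F (ζ, r * unitExp s) * cauchyCharge q r w s ∂arcMeasure) unitDisk := by
    refine differentiableOn_integral_of_continuousOn isCompact_Icc ae_mem_Icc_arcMeasure
      isOpen_unitDisk (Φ := fun ζ s => F (ζ, r * unitExp s) * cauchyCharge q r w s) ?_ fun s => ?_
    · refine ContinuousOn.mul (hF.continuousOn.comp (by fun_prop) fun y hy => ?_)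
        (hKc.comp continuous_snd).continuousOn
      exact ⟨hy.1, mul_unitExp_mem hr hr1 _⟩
    · exact (differentiableOn_fst_of_bidisk hF (mul_unitExp_mem hr hr1 s)).mul_const _
  have hzU : z ∈ unitDisk := mem_unitDisk.2 (hz.trans hr1)
  rw [torusPairing_eq_integral_integral hF hr hr1 (continuous_cauchyCharge p hz) hKc,
    integral_mul_cauchyCharge hdiff hr1 hz p, mixedPartial]
  refine Filter.EventuallyEq.iteratedDeriv_eq p ?_
  filter_upwards [isOpen_unitDisk.mem_nhds hzU] with ζ hζ using hin ζ hζ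

/-- Near each point the double Cauchy integral has a fixed contour, and `z` enters only through
charges holomorphic in `z`. -/
theorem differentiableOn_schwarzian (hF : DifferentiableOn ℂ F (unitDisk ×ˢ unitDisk))
    (p q : ℕ) : DifferentiableOn ℂ (schwarzian F p q) unitDisk := by
  intro z₀ hz₀
  obtain ⟨r, hr0, hr1⟩ := exists_between (mem_unitDisk.1 hz₀)
  have hr : 0 < r := (norm_nonneg z₀).trans_lt hr0
  have hμ : ∀ᵐ y ∂(arcMeasure.prod arcMeasure),
      y ∈ Icc 0 (2 * Real.pi) ×ˢ Icc 0 (2 * Real.pi) := ae_arcMeasure_prod fun y hy => hy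
  have hd : DifferentiableOn ℂ (fun z => torusPairing F r (cauchyCharge p r z)
      (cauchyCharge q r z)) (Metric.ball 0 r) := by
    refine differentiableOn_integral_of_continuousOn (isCompact_Icc.prod isCompact_Icc) hμ
      Metric.isOpen_ball (Φ := fun z y => F (r * unitExp y.1, r * unitExp y.2) *
        (cauchyCharge p r z y.1 * cauchyCharge q r z y.2)) ?_ fun y => ?_
    · refine ContinuousOn.mul ((continuous_torus hF hr hr1).comp continuous_snd).continuousOn
        (ContinuousOn.mul ?_ ?_)
      · exact (continuousOn_cauchyCharge p r).comp (f := fun y : ℂ × ℝ × ℝ => (y.1, y.2.1))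
          (by fun_prop) fun y hy => ⟨hy.1, trivial⟩
      · exact (continuousOn_cauchyCharge q r).comp (f := fun y : ℂ × ℝ × ℝ => (y.1, y.2.2))
          (by fun_prop) fun y hy => ⟨hy.1, trivial⟩
    · exact ((differentiableOn_cauchyCharge p r y.1).mul
        (differentiableOn_cauchyCharge q r y.2)).const_mul _
  have hz₀b : z₀ ∈ Metric.ball (0 : ℂ) r := by simpa using hr0
  refine ((hd.differentiableAt (Metric.isOpen_ball.mem_nhds hz₀b)).congr_of_eventuallyEq
    ?_).differentiableWithinAt
  filter_upwards [Metric.isOpen_ball.mem_nhds hz₀b] with z hz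
  have hz' : ‖z‖ < r := by simpa using hz
  exact mixedPartial_eq_torusPairing hF hr1 hz' hz' p q

theorem torusPairing_const_mul (F : ℂ × ℂ → ℂ) (r : ℝ) (X Y : ℝ → ℂ) (a b : ℂ) :
    torusPairing F r (fun t => a * X t) (fun t => b * Y t) = a * b * torusPairing F r X Y := by
  rw [torusPairing, torusPairing, ← integral_const_mul]
  congr 1
  ext y
  ring

theorem torusPairing_add (hF : DifferentiableOn ℂ F (unitDisk ×ˢ unitDisk)) {r : ℝ} (hr : 0 < r)
    (hr1 : r < 1) {X Y X' Y' : ℝ → ℂ} (hX : Continuous X) (hY : Continuous Y)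
    (hX' : Continuous X') (hY' : Continuous Y') :
    torusPairing F r (fun t => X t + X' t) (fun t => Y t + Y' t) =
      torusPairing F r X Y + torusPairing F r X Y' +
        (torusPairing F r X' Y + torusPairing F r X' Y') := by
  have hi : ∀ {A B : ℝ → ℂ}, Continuous A → Continuous B → Integrable (fun y : ℝ × ℝ =>
      F (r * unitExp y.1, r * unitExp y.2) * (A y.1 * B y.2)) (arcMeasure.prod arcMeasure) :=
    fun hA hB => (continuous_torus_mul hF hr hr1 hA hB).integrable_arcMeasure_prod
  simp only [torusPairing]
  rw [← integral_add (hi hX hY) (hi hX hY'), ← integral_add (hi hX' hY) (hi hX' hY'),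
    ← integral_add]
  · congr 1
    ext y
    ring
  · exact (hi hX hY).add (hi hX hY')
  · exact (hi hX' hY).add (hi hX' hY')

/-- Pairing with charges of negative frequencies only involves their real parts. -/
theorem re_torusPairing (hF : DifferentiableOn ℂ F (unitDisk ×ˢ unitDisk)) {r : ℝ} (hr : 0 < r)
    (hr1 : r < 1) {X Y : ℝ → ℂ} (hX : IsHardyCharge r X) (hY : IsHardyCharge r Y) :
    (torusPairing F r X Y).re =
      ∫ y, (F (r * unitExp y.1, r * unitExp y.2)).re * ((2 * (X y.1).re) * (2 * (Y y.2).re))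
        ∂(arcMeasure.prod arcMeasure) := by
  have hXc := hX.continuous
  have hYc := hY.continuous
  have hX' : Continuous fun t => (starRingEnd ℂ) (X t) := Complex.continuous_conj.comp hXc
  have hY' : Continuous fun t => (starRingEnd ℂ) (Y t) := Complex.continuous_conj.comp hYc
  have h1 : ∀ {Z : ℝ → ℂ}, Continuous Z →
      torusPairing F r (fun t => (starRingEnd ℂ) (X t)) Z = 0 := fun hZ => by
    rw [torusPairing_eq_integral_integral_symm hF hr hr1 hX' hZ]
    simp_rw [hX.annihilates _ (differentiableOn_fst_of_bidisk hF (mul_unitExp_mem hr hr1 _))]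
    simp
  have h2 : torusPairing F r X (fun t => (starRingEnd ℂ) (Y t)) = 0 := by
    rw [torusPairing_eq_integral_integral hF hr hr1 hXc hY']
    simp_rw [hY.annihilates _ (differentiableOn_snd_of_bidisk hF (mul_unitExp_mem hr hr1 _))]
    simp
  -- Of the four pairings in the expansion, three contain a conjugated charge and vanish, because
  -- `F` is holomorphic in that variable.
  have h3 : torusPairing F r (fun t => X t + (starRingEnd ℂ) (X t))
      (fun t => Y t + (starRingEnd ℂ) (Y t)) = torusPairing F r X Y := by
    rw [torusPairing_add hF hr hr1 hXc hYc hX' hY', h1 hYc, h1 hY', h2]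
    simp
  rw [← h3, torusPairing, ← RCLike.re_eq_complex_re, ← integral_re
    (continuous_torus_mul hF hr hr1 (hXc.fun_add hX') (hYc.fun_add hY')).integrable_arcMeasure_prod]
  congr 1
  ext y
  rw [Complex.add_conj, Complex.add_conj, ← Complex.ofReal_mul, RCLike.re_eq_complex_re,
    Complex.re_mul_ofReal]

end Bidisk

theorem IsHardyCharge.integral_re_eq_zero {r : ℝ} {X : ℝ → ℂ} (hX : IsHardyCharge r X) :
    ∫ t, 2 * (X t).re ∂arcMeasure = 0 := by
  have h := hX.annihilates (fun _ => 1) (differentiableOn_const _)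
  simp only [one_mul] at h
  rw [integral_conj, map_eq_zero] at h
  rw [integral_const_mul]
  have := integral_re (𝕜 := ℂ) (hX.continuous.integrable_arcMeasure)
  simp only [RCLike.re_eq_complex_re] at this
  rw [this, h]
  simp

/-- The conjugate charge annihilates `(w / r)^k` for `k ≥ 0`, so adding it changes no moment. -/
theorem IsHardyCharge.moment_re {r : ℝ} (hr : 0 < r) {X : ℝ → ℂ}
    (hX : IsHardyCharge r X) (k : ℕ) :
    moment (fun t => ((2 * (X t).re : ℝ) : ℂ)) k = moment X k := by
  have hr0 : (r : ℂ) ≠ 0 := by exact_mod_cast hr.ne'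
  have h := hX.annihilates (fun w => ((r : ℂ)⁻¹ * w) ^ k) (by fun_prop)
  simp only [inv_mul_cancel_left₀ hr0] at h
  have hX' : Continuous fun t => (starRingEnd ℂ) (X t) :=
    Complex.continuous_conj.comp hX.continuous
  have hXc := hX.continuous
  simp only [moment, ← Complex.add_conj, mul_add]
  rw [integral_add (Continuous.integrable_arcMeasure (by fun_prop))
    (Continuous.integrable_arcMeasure (by fun_prop)), h, add_zero]

theorem moment_add {X Y : ℝ → ℂ} (hX : Continuous X) (hY : Continuous Y) (k : ℕ) :
    moment (fun t => X t + Y t) k = moment X k + moment Y k := by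
  simp only [moment, mul_add]
  exact integral_add (Continuous.integrable_arcMeasure (by fun_prop))
    (Continuous.integrable_arcMeasure (by fun_prop))

theorem moment_const_mul (c : ℂ) (X : ℝ → ℂ) (k : ℕ) :
    moment (fun t => c * X t) k = c * moment X k := by
  simp only [moment, mul_left_comm _ c]
  exact integral_const_mul _ _

/-! ### Grunsky's inequality and the final estimate -/

section Grunsky

variable {f : ℂ → ℂ} {F : ℂ × ℂ → ℂ}

theorem ne_zero_of_isClassS (hf : IsClassS f) {z : ℂ} (hz : z ∈ unitDisk) (hz0 : z ≠ 0) :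
    f z ≠ 0 := fun h =>
  hz0 (hf.injective hz (by simp [unitDisk]) (h.trans hf.map_zero.symm))

/-- Off the diagonal, `1 / f z - 1 / f w` equals `-(z - w) / (z * w)` times the quotient, whose
modulus is `exp (Re F)`; the factor `r` normalizes `|z| = |w| = r`. -/
theorem norm_inv_sub_inv (hf : IsClassS f) (hF : IsLogBranch f F) {r : ℝ} (hr : 0 < r)
    (hr1 : r < 1) (t s : ℝ) :
    ‖(r : ℂ) / f (r * unitExp t) - r / f (r * unitExp s)‖ ^ 2 = ‖unitExp t - unitExp s‖ ^ 2 *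
      Real.exp (2 * (F (r * unitExp t, r * unitExp s)).re) := by
  have hr0 : (r : ℂ) ≠ 0 := by exact_mod_cast hr.ne'
  by_cases h : unitExp t = unitExp s
  · simp [h]
  set z := (r : ℂ) * unitExp t with hz
  set w := (r : ℂ) * unitExp s with hw
  have hzU : z ∈ unitDisk := mul_unitExp_mem hr hr1 t
  have hwU : w ∈ unitDisk := mul_unitExp_mem hr hr1 s
  have hz0 : z ≠ 0 := mul_ne_zero hr0 (unitExp_ne_zero t)
  have hw0 : w ≠ 0 := mul_ne_zero hr0 (unitExp_ne_zero s)
  have hwz : w ≠ z := fun e => h (mul_left_cancel₀ hr0 e.symm)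
  have hfz := ne_zero_of_isClassS hf hzU hz0
  have hfw := ne_zero_of_isClassS hf hwU hw0
  have hexp := hF.exp_eq z hzU w hwU
  rw [quotient, dslope_of_ne _ hwz, dslope_of_ne _ hz0, dslope_of_ne _ hw0, slope_def_field,
    slope_def_field, slope_def_field, hf.map_zero] at hexp
  have hkey : (r : ℂ) / f z - r / f w =
      -(unitExp t - unitExp s) * Complex.exp (F (z, w)) * ((unitExp t)⁻¹ * (unitExp s)⁻¹) := by
    rw [hexp]
    have hut := unitExp_ne_zero t
    have hus := unitExp_ne_zero s
    have hsub : unitExp s - unitExp t ≠ 0 := sub_ne_zero.2 (Ne.symm h)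
    have e1 : w - z = r * (unitExp s - unitExp t) := by rw [hz, hw]; ring
    rw [e1]
    simp only [sub_zero]
    field_simp
    rw [hz, hw]
    ring
  rw [hkey, norm_mul, norm_mul, norm_neg, norm_mul, norm_inv, norm_inv, norm_unitExp,
    norm_unitExp, Complex.norm_exp, mul_pow, mul_pow, ← Real.exp_nat_mul]
  simp

/-- **Grunsky's inequality**, in quadratic form. -/
theorem re_torusPairing_self_le (hf : IsClassS f) (hF : IsLogBranch f F) {r : ℝ} (hr : 0 < r)
    (hr1 : r < 1) {X : ℝ → ℂ} (hX : IsHardyCharge r X)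
    (hs : Summable fun k : ℕ => ‖moment X k‖ ^ 2 / k) :
    (torusPairing F r X X).re ≤ ∑' k : ℕ, ‖moment X k‖ ^ 2 / k := by
  have hfc : Continuous fun t => (r : ℂ) / f (r * unitExp t) := by
    refine Continuous.div continuous_const
      (continuous_comp_mul_unitExp hf.analytic.continuousOn hr hr1) fun t => ?_
    refine ne_zero_of_isClassS hf (mul_unitExp_mem hr hr1 t) (mul_ne_zero ?_ (unitExp_ne_zero t))
    exact_mod_cast hr.ne'
  have hXc := hX.continuous
  have hre : Continuous fun t => 2 * (X t).re := by
    have := Complex.continuous_re.comp hXc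
    exact continuous_const.mul this
  have h := integral_distortion_le hfc
    (Φ := fun y => (F (r * unitExp y.1, r * unitExp y.2)).re)
    (Complex.continuous_re.comp (continuous_torus hF.analytic hr hr1))
    (fun t s => norm_inv_sub_inv hf hF hr hr1 t s) hre hX.integral_re_eq_zero
  simp_rw [hX.moment_re hr] at h
  rw [re_torusPairing hF.analytic hr hr1 hX hX]
  exact h hs

/-- Symmetry of the quotient makes `|exp F|`, and so `Re F`, symmetric. Working with real parts
avoids the ambiguity of `2πi`. -/
theorem re_torusPairing_comm (hF : IsLogBranch f F) {r : ℝ} (hr : 0 < r)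
    (hr1 : r < 1) {X Y : ℝ → ℂ} (hX : IsHardyCharge r X) (hY : IsHardyCharge r Y) :
    (torusPairing F r X Y).re = (torusPairing F r Y X).re := by
  rw [re_torusPairing hF.analytic hr hr1 hX hY, re_torusPairing hF.analytic hr hr1 hY hX,
    ← integral_prod_swap]
  congr 1
  ext y
  have hsymm : (F (r * unitExp y.2, r * unitExp y.1)).re =
      (F (r * unitExp y.1, r * unitExp y.2)).re := by
    have h1 := hF.exp_eq _ (mul_unitExp_mem hr hr1 y.1) _ (mul_unitExp_mem hr hr1 y.2)
    have h2 := hF.exp_eq _ (mul_unitExp_mem hr hr1 y.2) _ (mul_unitExp_mem hr hr1 y.1)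
    have h3 : quotient f (r * unitExp y.1) (r * unitExp y.2) =
        quotient f (r * unitExp y.2) (r * unitExp y.1) := by
      rw [quotient, quotient, dslope_comm f (r * unitExp y.1)]
      ring
    have h4 := congrArg norm ((h2.trans h3.symm).trans h1.symm)
    rwa [Complex.norm_exp, Complex.norm_exp, Real.exp_eq_exp] at h4
  simp only [Prod.fst_swap, Prod.snd_swap]
  rw [hsymm]
  ring

/-- Polarization with `X + Y` and `i (X - Y)`: the pairing is bilinear, so the factor `i` flips the
sign and the pure terms cancel, while the energies add up by the parallelogram law. -/
theorem re_torusPairing_le (hf : IsClassS f) (hF : IsLogBranch f F) {r : ℝ} (hr : 0 < r)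
    (hr1 : r < 1) {X Y : ℝ → ℂ} (hX : IsHardyCharge r X) (hY : IsHardyCharge r Y)
    (hXs : Summable fun k : ℕ => ‖moment X k‖ ^ 2 / k)
    (hYs : Summable fun k : ℕ => ‖moment Y k‖ ^ 2 / k) :
    2 * (torusPairing F r X Y).re ≤
      ∑' k : ℕ, ‖moment X k‖ ^ 2 / k + ∑' k : ℕ, ‖moment Y k‖ ^ 2 / k := by
  have hXc := hX.continuous
  have hYc := hY.continuous
  have hI := Complex.I_mul_I
  have hP : IsHardyCharge r (fun t => X t + Y t) := hX.add hr hr1 hY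
  have hM : IsHardyCharge r (fun t => Complex.I * X t + -Complex.I * Y t) :=
    (hX.const_mul _).add hr hr1 (hY.const_mul _)
  have hPm : ∀ k, moment (fun t => X t + Y t) k = moment X k + moment Y k := moment_add hXc hYc
  have hMm : ∀ k, moment (fun t => Complex.I * X t + -Complex.I * Y t) k =
      Complex.I * (moment X k - moment Y k) := fun k => by
    rw [moment_add (by fun_prop) (by fun_prop), moment_const_mul, moment_const_mul]
    ring
  have hsumXY := (hXs.add hYs).mul_left 2
  have hpar : ∀ k : ℕ, ‖moment X k + moment Y k‖ ^ 2 / k +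
      ‖Complex.I * (moment X k - moment Y k)‖ ^ 2 / k =
      2 * (‖moment X k‖ ^ 2 / k + ‖moment Y k‖ ^ 2 / k) := by
    intro k
    have := parallelogram_law_with_norm ℝ (moment X k) (moment Y k)
    rw [norm_mul, Complex.norm_I, one_mul, ← add_div, ← add_div, this]
    ring
  have hPs : Summable fun k : ℕ => ‖moment X k + moment Y k‖ ^ 2 / k :=
    hsumXY.of_nonneg_of_le (fun k => by positivity) fun k => by
      rw [← hpar k]
      exact le_add_of_nonneg_right (by positivity)
  have hMs : Summable fun k : ℕ => ‖Complex.I * (moment X k - moment Y k)‖ ^ 2 / k :=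
    hsumXY.of_nonneg_of_le (fun k => by positivity) fun k => by
      rw [← hpar k]
      exact le_add_of_nonneg_left (by positivity)
  have h1 := re_torusPairing_self_le hf hF hr hr1 hP (by simpa only [hPm] using hPs)
  have h2 := re_torusPairing_self_le hf hF hr hr1 hM (by simpa only [hMm] using hMs)
  simp only [hPm] at h1
  simp only [hMm] at h2
  have hadd := add_le_add h1 h2
  rw [← hPs.tsum_add hMs, tsum_congr hpar, tsum_mul_left, hXs.tsum_add hYs,
    torusPairing_add hF.analytic hr hr1 hXc hXc hYc hYc,
    torusPairing_add hF.analytic hr hr1 (hXc.const_mul _) (hXc.const_mul _)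
      (hYc.const_mul _) (hYc.const_mul _)] at hadd
  rw [torusPairing_const_mul, torusPairing_const_mul, torusPairing_const_mul,
    torusPairing_const_mul] at hadd
  simp only [mul_neg, neg_mul, hI, neg_neg, one_mul, Complex.add_re, Complex.neg_re] at hadd
  have hcomm := re_torusPairing_comm hF hr hr1 hX hY
  linarith

/-- **Grunsky's inequality**, in bilinear form. -/
theorem norm_torusPairing_le (hf : IsClassS f) (hF : IsLogBranch f F) {r : ℝ} (hr : 0 < r)
    (hr1 : r < 1) {X Y : ℝ → ℂ} (hX : IsHardyCharge r X) (hY : IsHardyCharge r Y)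
    (hXs : Summable fun k : ℕ => ‖moment X k‖ ^ 2 / k)
    (hYs : Summable fun k : ℕ => ‖moment Y k‖ ^ 2 / k) {A B : ℝ} (hA : 0 < A) (hB : 0 < B)
    (hXA : ∑' k : ℕ, ‖moment X k‖ ^ 2 / k ≤ A ^ 2)
    (hYB : ∑' k : ℕ, ‖moment Y k‖ ^ 2 / k ≤ B ^ 2) :
    ‖torusPairing F r X Y‖ ≤ A * B := by
  set b := torusPairing F r X Y with hb
  -- The phase `c` makes the pairing a nonnegative real; scaling by `A⁻¹` and `B⁻¹` brings both
  -- energies to at most `1`, where the additive bound becomes the product bound.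
  obtain ⟨c, hc, hcb⟩ : ∃ c : ℂ, ‖c‖ = 1 ∧ c * b = ‖b‖ := by
    by_cases h0 : b = 0
    · exact ⟨1, by simp, by simp [h0]⟩
    · have hn : (‖b‖ : ℂ) ≠ 0 := by exact_mod_cast norm_ne_zero_iff.2 h0
      refine ⟨‖b‖ / b, by simp [h0], by field_simp⟩
  have key : ∀ (d : ℂ) (C : ℝ) {Z : ℝ → ℂ}, 0 < C → ‖d‖ = C⁻¹ →
      (Summable fun k : ℕ => ‖moment Z k‖ ^ 2 / k) → ∑' k : ℕ, ‖moment Z k‖ ^ 2 / k ≤ C ^ 2 →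
      (Summable fun k : ℕ => ‖moment (fun t => d * Z t) k‖ ^ 2 / k) ∧
        ∑' k : ℕ, ‖moment (fun t => d * Z t) k‖ ^ 2 / k ≤ 1 := by
    intro d C Z hC hd hZ hle
    have e : ∀ k : ℕ, ‖moment (fun t => d * Z t) k‖ ^ 2 / k =
        (C⁻¹) ^ 2 * (‖moment Z k‖ ^ 2 / k) := fun k => by
      rw [moment_const_mul, norm_mul, hd]
      ring
    simp only [e]
    refine ⟨hZ.mul_left _, ?_⟩
    rw [tsum_mul_left, inv_pow, inv_mul_le_iff₀ (by positivity), mul_one]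
    exact hle
  obtain ⟨s1, l1⟩ := key (A⁻¹ : ℝ) A hA (by simp [abs_of_pos hA]) hXs hXA
  obtain ⟨s2, l2⟩ := key ((B⁻¹ : ℝ) * c) B hB (by simp [abs_of_pos hB, hc]) hYs hYB
  have h := re_torusPairing_le hf hF hr hr1 (hX.const_mul (A⁻¹ : ℝ))
    (hY.const_mul ((B⁻¹ : ℝ) * c)) s1 s2
  rw [torusPairing_const_mul, ← hb] at h
  have e : ((A⁻¹ : ℝ) : ℂ) * (((B⁻¹ : ℝ) : ℂ) * c) * b = ((A⁻¹ * B⁻¹ * ‖b‖ : ℝ) : ℂ) := by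
    push_cast
    rw [← hcb]
    ring
  rw [e, Complex.ofReal_re] at h
  have h2 : A⁻¹ * B⁻¹ * ‖b‖ ≤ 1 := by linarith
  rwa [← mul_inv, inv_mul_le_iff₀ (by positivity), mul_one] at h2

theorem norm_mixedPartial_le_of_lt (hf : IsClassS f) (hF : IsLogBranch f F) {p q : ℕ}
    (hp : 1 ≤ p) (hq : 1 ≤ q) {r : ℝ} (hr1 : r < 1) {z w : ℂ} (hz : ‖z‖ < r) (hw : ‖w‖ < r) :
    ‖mixedPartial F p q z w‖ ≤
      (√((2 * p - 1).factorial) * (r / (r ^ 2 - ‖z‖ ^ 2)) ^ p) *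
        (√((2 * q - 1).factorial) * (r / (r ^ 2 - ‖w‖ ^ 2)) ^ q) := by
  have hr : 0 < r := (norm_nonneg z).trans_lt hz
  obtain ⟨s1, l1⟩ := energy_cauchyCharge hp hr1 hz
  obtain ⟨s2, l2⟩ := energy_cauchyCharge hq hr1 hw
  have hpos : ∀ {v : ℂ}, ‖v‖ < r → 0 < r / (r ^ 2 - ‖v‖ ^ 2) := fun {v} hv =>
    div_pos hr (by nlinarith [norm_nonneg v])
  have hsq : ∀ (n : ℕ) (v : ℝ), (√((2 * n - 1).factorial : ℝ) * v ^ n) ^ 2 =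
      (2 * n - 1).factorial * v ^ (2 * n) := fun n v => by
    rw [mul_pow, Real.sq_sqrt (by positivity)]
    ring
  have hfac : ∀ n : ℕ, 0 < √((2 * n - 1).factorial : ℝ) := fun n =>
    Real.sqrt_pos.2 (by exact_mod_cast Nat.factorial_pos _)
  rw [mixedPartial_eq_torusPairing hF.analytic hr1 hz hw]
  exact norm_torusPairing_le hf hF hr hr1 (isHardyCharge_cauchyCharge hp hr1 hz)
    (isHardyCharge_cauchyCharge hq hr1 hw) s1 s2 (mul_pos (hfac p) (pow_pos (hpos hz) p))
    (mul_pos (hfac q) (pow_pos (hpos hw) q)) (by rw [hsq]; exact l1) (by rw [hsq]; exact l2)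

theorem norm_schwarzian_mul_le (hf : IsClassS f) (hF : IsLogBranch f F) {p q : ℕ}
    (hp : 1 ≤ p) (hq : 1 ≤ q) {z : ℂ} (hz : z ∈ unitDisk) :
    ‖schwarzian F p q z‖ * (1 - ‖z‖ ^ 2) ^ ((p : ℝ) + (q : ℝ)) ≤
      √(((2 * p - 1).factorial : ℝ) * ((2 * q - 1).factorial : ℝ)) := by
  have hz1 : ‖z‖ < 1 := mem_unitDisk.1 hz
  have hpos : 0 < 1 - ‖z‖ ^ 2 := by nlinarith [norm_nonneg z]
  set φ : ℝ → ℝ := fun r => (√((2 * p - 1).factorial) * (r / (r ^ 2 - ‖z‖ ^ 2)) ^ p) *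
        (√((2 * q - 1).factorial) * (r / (r ^ 2 - ‖z‖ ^ 2)) ^ q) with hφ
  have hle : ∀ᶠ r in 𝓝[<] (1 : ℝ), ‖schwarzian F p q z‖ ≤ φ r := by
    filter_upwards [Ioo_mem_nhdsLT hz1] with r hr
    exact norm_mixedPartial_le_of_lt hf hF hp hq hr.2 hr.1 hr.1
  have hcont : ContinuousAt φ 1 := by
    have : ContinuousAt (fun r : ℝ => r / (r ^ 2 - ‖z‖ ^ 2)) 1 :=
      ContinuousAt.div (by fun_prop) (by fun_prop) (by simpa using hpos.ne')
    fun_prop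
  -- The estimate holds for every `r` between `|z|` and `1`, so it passes to the limit `r → 1`.
  have h := ge_of_tendsto (hcont.tendsto.mono_left nhdsWithin_le_nhds) hle
  have hrpow : (1 - ‖z‖ ^ 2) ^ ((p : ℝ) + (q : ℝ)) = (1 - ‖z‖ ^ 2) ^ (p + q) := by
    rw [← Nat.cast_add, Real.rpow_natCast]
  rw [hrpow, Real.sqrt_mul (by positivity), ← le_div_iff₀ (by positivity)]
  refine h.trans (le_of_eq ?_)
  simp only [hφ, one_pow, one_div, inv_pow]
  rw [pow_add]
  field_simp

end Grunsky

end HigherSchwarzian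

theorem proposition3p2 (f : ℂ → ℂ) (hf : HigherSchwarzian.IsClassS f)
    (p q : ℕ) (hp : 1 ≤ p) (hq : 1 ≤ q) :
    (∃ F : ℂ × ℂ → ℂ, HigherSchwarzian.IsLogBranch f F) ∧
    ∀ F : ℂ × ℂ → ℂ, HigherSchwarzian.IsLogBranch f F →
      HigherSchwarzian.MemGrowth ((p : ℝ) + (q : ℝ)) (HigherSchwarzian.schwarzian F p q) ∧
      HigherSchwarzian.growthNorm ((p : ℝ) + (q : ℝ)) (HigherSchwarzian.schwarzian F p q) ≤
        Real.sqrt ((Nat.factorial (2 * p - 1) : ℝ) * (Nat.factorial (2 * q - 1) : ℝ)) := by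
  refine ⟨HigherSchwarzian.exists_isLogBranch hf, fun F hF => ?_⟩
  have hle := fun z : HigherSchwarzian.unitDisk =>
    HigherSchwarzian.norm_schwarzian_mul_le hf hF hp hq z.2
  refine ⟨⟨HigherSchwarzian.differentiableOn_schwarzian hF.analytic p q, ?_⟩, ?_⟩
  · exact ⟨_, forall_mem_range.2 hle⟩
  · have : Nonempty HigherSchwarzian.unitDisk := ⟨⟨0, by simp [HigherSchwarzian.unitDisk]⟩⟩
    exact ciSup_le hle
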